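/- Let $r\ge 5$ and $n\ge 3$ be integers, $q=e^{\pi \mathsf i/r}$, $q^x=e^{\pi\mathsf i x/r}$, $s=q^{r-1}$, $\{x\}=q^x-q^{-x}$, $[x]=\{x\}/\{1\}$, $\{a\}!=\{a\}\{a-1\}\cdots\{1\}$. Let $V$ be the $\mathbb C$-vector space with basis $u_0,\dots,u_{r-1}$ and operators $$k\,u_m=q^{(r-1-2m)/2}u_m,\qquad E\,u_m=u_{m-1},\qquad F\,u_m=[m+1][r-1-m]\,u_{m+1}\qquad(u_{-1}=u_r=0).$$ On $V^{\otimes n}$ let $E$ and $F$ act by $\sum_{i=1}^n 1^{\otimes (i-1)}\otimes E\otimes (k^2)^{\otimes (n-i)}$ and $\sum_{i=1}^n (k^{-2})^{\otimes (i-1)}\otimes F\otimes 1^{\otimes (n-i)}$. Let $$R=\frac1{4r}\sum_{a=0}^{r-1}\sum_{m,m'=0}^{4r-1}\frac{\{1\}^{2a}}{\{a\}!}\,q^{a(a-1)/2+a(m-m')-mm'/2}\,E^ak^m\otimes F^ak^{m'}$$ on $V\otimes V$, let $\tau$ be the flip, and $\mathsf R=q^{-(r-1)^2/2}\,\tau\circ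 R$. Let $\boldsymbol V_{n,2}\subset V^{\otimes n}$ be the span of the vectors $u_{\varepsilon_1}\otimes\cdots\otimes u_{\varepsilon_n}$ with $\varepsilon_1+\dots+\varepsilon_n=2$. For $\ell'\in\{0,1\}$ with $\ell'\equiv 1-n-2 \pmod r$ (that is, $n\equiv-1\pmod r$ for $\ell'=0$ and $n\equiv-2\pmod r$ for $\ell'=1$) put $$\boldsymbol N_{n,2,\ell'}=\ker\big((FE)^2\big)\cap \boldsymbol V_{n,2}.$$ **Proposition.** Suppose that $\ell'\in\{0,1\}$ and $\ell'\equiv 1-n-2\pmod r$. There is a (necessarily unique) representation $\rho$ of the braid group $B_n$ on $\boldsymbol N_{n,2,\ell'}$ in which each standard generator $\sigma_i$ ($1\le i<n$) acts by the restriction of $1^{\otimes(i-1)}\otimes\mathsf R\otimes 1^{\otimes(n-i-1)}$, and this representation is not faithful. Moreover, for every $1\le i<n$: 1. the minimal polynomial of $\rho(\sigma_i)$ is $(X-1)(X+s^{-2})(X-s^{-4}q^2)$, and $\rho(\sigma_i)$ is diagonalizable; 2. if $r$ is even, then $\langle\sigma_i^{\,r}\rangle\subseteq\ker\rho$; 3.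 if $r$ is odd, then $\langle\sigma_i^{\,2r}\rangle\subseteq\ker\rho$. -/

import Mathlib

open scoped TensorProduct

noncomputable section

namespace BraidExt

/-! ### The braid group -/

/-- The standard relations of the braid group on `n` strands, with generators
`σ_0, …, σ_{n-2}`. -/
def braidRels (n : ℕ) : Set (FreeGroup (Fin (n - 1))) :=
  {w | ∃ i j : Fin (n - 1), (i : ℕ) + 1 < (j : ℕ) ∧
      w = (.of i * .of j) * (.of j * .of i)⁻¹} ∪
  {w | ∃ i j : Fin (n - 1), (i : ℕ) + 1 = (j : ℕ) ∧
      w = (.of i * .of j * .of i) * (.of j * .of i * .of j)⁻¹}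

/-- The braid group `B_n`. -/
abbrev BraidGroup (n : ℕ) : Type := PresentedGroup (braidRels n)

/-- The generator of `B_n` crossing the (0-based) strands `i` and `i + 1`. -/
def sigma {n : ℕ} (i : Fin (n - 1)) : BraidGroup n := PresentedGroup.of i

/-! ### Quantum numbers at `q = exp (π i / r)` -/

/-- `q ^ x`, where `q = exp (π i / r)`; in particular `q ^ (1/2) = exp (π i / (2 r))`. -/
def qp (r : ℕ) (x : ℂ) : ℂ := Complex.exp (Real.pi * Complex.I * x / r)

/-- `{x} = q ^ x - q ^ (-x)`. -/
def qnum (r : ℕ) (x : ℂ) : ℂ := qp r x - qp r (-x)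

/-- `[x] = {x} / {1}`. -/
def qint (r : ℕ) (x : ℂ) : ℂ := qnum r x / qnum r 1

/-- `{a}! = {a} {a-1} ⋯ {1}`. -/
def qnumFact (r a : ℕ) : ℂ := ∏ j ∈ Finset.range a, qnum r ((j : ℂ) + 1)

/-- `s = q ^ (r - 1)`. -/
def sParam (r : ℕ) : ℂ := qp r ((r : ℂ) - 1)

/-! ### The module `V_{r-1}` -/

/-- The underlying space of the simple projective module `V_{r-1}`, of dimension `r`. -/
def V (r : ℕ) : Type := Fin r → ℂ

instance (r : ℕ) : AddCommGroup (V r) := inferInstanceAs (AddCommGroup (Fin r → ℂ))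

instance (r : ℕ) : Module ℂ (V r) := inferInstanceAs (Module ℂ (Fin r → ℂ))

/-- The standard basis of `V_{r-1}`. -/
def uBasis (r : ℕ) : Module.Basis (Fin r) ℂ (V r) := Pi.basisFun ℂ (Fin r)

/-- The basis vectors `u_0, …, u_{r-1}`, with `u_m = 0` for `m ≥ r`. -/
def u (r m : ℕ) : V r := if h : m < r then uBasis r ⟨m, h⟩ else 0

/-- `E u_m = u_{m-1}`, with `u_{-1} = 0`. -/
def E (r : ℕ) : Module.End ℂ (V r) :=
  (uBasis r).constr ℂ fun m =>
    if (m : ℕ) = 0 then 0 else u r ((m : ℕ) - 1)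

/-- `F u_m = [m + 1] [r - 1 - m] u_{m+1}`, with `u_r = 0`. -/
def F (r : ℕ) : Module.End ℂ (V r) :=
  (uBasis r).constr ℂ fun m =>
    (qint r ((m : ℕ) + 1) * qint r ((r : ℂ) - 1 - (m : ℕ))) • u r ((m : ℕ) + 1)

/-- `k u_m = q ^ ((r - 1 - 2 m) / 2) u_m`. -/
def k (r : ℕ) : Module.End ℂ (V r) :=
  (uBasis r).constr ℂ fun m =>
    qp r (((r : ℂ) - 1 - 2 * (m : ℕ)) / 2) • u r m

/-- The action of `k⁻¹`. -/
def kInv (r : ℕ) : Module.End ℂ (V r) :=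
  (uBasis r).constr ℂ fun m =>
    qp r (-(((r : ℂ) - 1 - 2 * (m : ℕ)) / 2)) • u r m

/-! ### The tensor power `V_{r-1}^{⊗ n}` -/

/-- `V_{r-1}^{⊗ n}`. -/
abbrev VT (r n : ℕ) : Type := ⨂[ℂ] _ : Fin n, V r

/-- The action of `E` on `V_{r-1}^{⊗ n}` through the iterated coproduct of
`Δ(E) = 1 ⊗ E + E ⊗ k²`, i.e. `∑ i, 1 ⊗ ⋯ ⊗ 1 ⊗ E ⊗ k² ⊗ ⋯ ⊗ k²`. -/
def ET (r n : ℕ) : Module.End ℂ (VT r n) :=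
  ∑ i : Fin n, PiTensorProduct.map fun j : Fin n =>
    if j < i then (1 : Module.End ℂ (V r)) else if j = i then E r else k r ^ 2

/-- The action of `F` on `V_{r-1}^{⊗ n}` through the iterated coproduct of
`Δ(F) = k⁻² ⊗ F + F ⊗ 1`, i.e. `∑ i, k⁻² ⊗ ⋯ ⊗ k⁻² ⊗ F ⊗ 1 ⊗ ⋯ ⊗ 1`. -/
def FT (r n : ℕ) : Module.End ℂ (VT r n) :=
  ∑ i : Fin n, PiTensorProduct.map fun j : Fin n =>
    if j < i then kInv r ^ 2 else if j = i then F r else (1 : Module.End ℂ (V r))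

/-- The operator `1 ⊗ ⋯ ⊗ A ⊗ ⋯ ⊗ B ⊗ ⋯ ⊗ 1` with `A` in the factor `i` and `B` in the
factor `j` (for `i ≠ j`). -/
def twoSite {r n : ℕ} (i j : Fin n) (A B : Module.End ℂ (V r)) : Module.End ℂ (VT r n) :=
  PiTensorProduct.map fun l : Fin n => if l = i then A else if l = j then B else 1

/-- The universal `R`-matrix
`1/(4r) ∑_a ∑_{m,m'} {1}^{2a}/{a}! q^{a(a-1)/2 + a(m-m') - mm'/2} E^a k^m ⊗ F^a k^{m'}`
acting on the tensor factors `i` and `j`. -/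
def RMat (r n : ℕ) (i j : Fin n) : Module.End ℂ (VT r n) :=
  (1 / (4 * (r : ℂ))) •
    ∑ a ∈ Finset.range r, ∑ m ∈ Finset.range (4 * r), ∑ m' ∈ Finset.range (4 * r),
      (qnum r 1 ^ (2 * a) / qnumFact r a *
        qp r ((a : ℂ) * ((a : ℂ) - 1) / 2 + (a : ℂ) * ((m : ℂ) - (m' : ℂ))
          - (m : ℂ) * (m' : ℂ) / 2)) •
        twoSite i j (E r ^ a * k r ^ m) (F r ^ a * k r ^ m')

/-- The flip of the tensor factors `i` and `j`. -/
def flipOp (r n : ℕ) (i j : Fin n) : Module.End ℂ (VT r n) :=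
  (PiTensorProduct.reindex ℂ (fun _ : Fin n => V r) (Equiv.swap i j)).toLinearMap

/-- The operator `1^{⊗ i} ⊗ (q^{-(r-1)²/2} τ ∘ R) ⊗ 1^{⊗ (n-i-2)}` on `V_{r-1}^{⊗ n}`, acting in
the (0-based) tensor factors `i` and `i + 1`. -/
def braidOp (r n : ℕ) (i : Fin (n - 1)) : Module.End ℂ (VT r n) :=
  let i₀ : Fin n := ⟨i, by omega⟩
  let i₁ : Fin n := ⟨i + 1, by omega⟩
  qp r (-((r : ℂ) - 1) ^ 2 / 2) • (flipOp r n i₀ i₁ ∘ₗ RMat r n i₀ i₁)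

/-! ### The dominant spaces -/

/-- The strong weight space `V_{n,ℓ}`, spanned by the `u_{ε_1} ⊗ ⋯ ⊗ u_{ε_n}` with
`ε_1 + ⋯ + ε_n = ℓ`. -/
def weightSpace (r n l : ℕ) : Submodule ℂ (VT r n) :=
  Submodule.span ℂ
    {x | ∃ ε : Fin n → Fin r, ∑ i, (ε i : ℕ) = l ∧
      x = PiTensorProduct.tprod ℂ fun i => u r (ε i)}

/-- The dominant space `N_{n,ℓ} = ker (F E)² ∩ V_{n,ℓ}`. -/
def dominantSpace (r n l : ℕ) : Submodule ℂ (VT r n) :=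
  LinearMap.ker ((FT r n * ET r n) ^ 2) ⊓ weightSpace r n l

/-- `ρ` is the representation of `B_n` on `N_{n,ℓ}` given by the `R`-matrix: each generator acts
by restriction of the operator `braidOp`. Such a `ρ` is unique, as the `sigma i` generate. -/
def IsDominantRep {r n l : ℕ}
    (ρ : Representation ℂ (BraidGroup n) (dominantSpace r n l)) : Prop :=
  ∀ (i : Fin (n - 1)) (w : dominantSpace r n l),
    ((ρ (sigma i) w : dominantSpace r n l) : VT r n) = braidOp r n i (w : VT r n)

/-- The cubic polynomial `(X - 1) (X + s⁻²) (X - s⁻⁴ q²)`. -/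
def cubic (r : ℕ) : Polynomial ℂ :=
  (Polynomial.X - 1) * (Polynomial.X + Polynomial.C (sParam r ^ (-2 : ℤ))) *
    (Polynomial.X - Polynomial.C (sParam r ^ (-4 : ℤ) * qp r 1 ^ 2))

/-- An endomorphism is diagonalizable if it has a basis of eigenvectors. -/
def IsDiagonalizable {M : Type*} [AddCommGroup M] [Module ℂ M] (f : Module.End ℂ M) : Prop :=
  ∃ (ι : Type) (b : Module.Basis ι ℂ M) (μ : ι → ℂ), ∀ j, f (b j) = μ j • b j

end BraidExt

end

noncomputable section

namespace BraidExt

open Function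

/-! ### Roots of unity -/

/-! Since $q^r=-1$, one has $s=-q^{-1}$, and the cubic has the roots $1$, $-q^2$, $q^6$. The sums
over $m,m'$ in $R$ form a Gaussian double sum over the primitive $4r$-th root of unity $q^{1/2}$, so
$R$ has explicit coefficients on basis vectors. On $u_b\otimes u_c$ with $b+c\le 2$ only $a\le 2$
contributes, which leaves the six formulas of `BraidRules`.

These formulas reduce every statement about $\boldsymbol V_{n,2}$ to finitely many local identities
in $q$: the cubic relation (`cubic_apply`), the braid and far commutation relations (`braid_apply`,
`commute_apply`), and compatibility with $E$ and $F$ (`lower_apply`, `raise_apply`). Hence the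
operators commute with $FE$ on $\boldsymbol V_{n,2}$ and preserve the dominant space. The cubic has
nonzero constant term, so their restrictions are invertible and define $\rho$.

For $r\ge5$ the three roots are distinct, which gives diagonalizability. Each root is an eigenvalue
of $\rho(\sigma_1)$ by an explicit vector in $\ker E$ supported on three strands, and the braid
relation carries eigenvalues to the other generators; so the cubic is the minimal polynomial. All
three roots have $m$-th power $1$ when $m$ is even and divisible by $r$, whereas $\sigma_i$ has
infinite order by exponent sum; so $\rho$ is not faithful. -/

theorem sum_zpow_pow_eq_ite {K : Type*} [Field K] {N : ℕ} {ζ : K} (hζ : IsPrimitiveRoot ζ N)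
    (e : ℤ) : ∑ m ∈ Finset.range N, (ζ ^ e) ^ m = if (N : ℤ) ∣ e then (N : K) else 0 := by
  split_ifs with h
  · simp [(hζ.zpow_eq_one_iff_dvd e).2 h]
  · have h1 : ζ ^ e - 1 ≠ 0 := fun h' => h ((hζ.zpow_eq_one_iff_dvd e).1 (sub_eq_zero.1 h'))
    refine (mul_eq_zero.1 (?_ : (ζ ^ e - 1) * _ = 0)).resolve_left h1
    rw [mul_geom_sum, ← zpow_natCast, ← zpow_mul, mul_comm, zpow_mul, zpow_natCast, hζ.pow_eq_one,
      one_zpow, sub_self]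

/-- A finite Gaussian double sum over a primitive root of unity. -/
theorem sum_sum_zpow_sub_mul {K : Type*} [Field K] {N : ℕ} {ζ : K} (hN : 0 < N)
    (hζ : IsPrimitiveRoot ζ N) (x y : ℤ) :
    ∑ m ∈ Finset.range N, ∑ m' ∈ Finset.range N, ζ ^ (x * (m : ℤ) + y * (m' : ℤ) - m * m') =
      N * ζ ^ (x * y) := by
  have hζ0 : ζ ≠ 0 := hζ.ne_zero hN.ne'
  -- The sum over `m'` is geometric and vanishes unless `m ≡ y` mod `N`; exactly one `m` in the
  -- range survives.
  have h1 : ∀ m ∈ Finset.range N,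
      ∑ m' ∈ Finset.range N, ζ ^ (x * (m : ℤ) + y * (m' : ℤ) - m * m') =
        if m = (y % N).toNat then (N : K) * ζ ^ (x * y) else 0 := by
    intro m hm
    have hm' : m < N := Finset.mem_range.1 hm
    have h2 : ∀ m' ∈ Finset.range N, ζ ^ (x * (m : ℤ) + y * (m' : ℤ) - m * m') =
        ζ ^ (x * (m : ℤ)) * (ζ ^ (y - m : ℤ)) ^ m' := by
      intro m' _
      rw [← zpow_natCast (ζ ^ (y - m : ℤ)), ← zpow_mul, ← zpow_add₀ hζ0]
      congr 1; ring
    rw [Finset.sum_congr rfl h2, ← Finset.mul_sum, sum_zpow_pow_eq_ite hζ]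
    have hy0 := Int.emod_nonneg y (show (N : ℤ) ≠ 0 by omega)
    have hyN := Int.emod_lt_of_pos y (show (0 : ℤ) < N by omega)
    have hiff : (N : ℤ) ∣ y - m ↔ m = (y % N).toNat := by
      rw [← Int.modEq_iff_dvd, Int.ModEq, Int.emod_eq_of_lt (by omega) (by omega)]
      omega
    simp only [hiff]
    split_ifs with h
    · have h3 : ζ ^ (x * (m : ℤ)) = ζ ^ (x * y) := by
        obtain ⟨t, ht⟩ := hiff.2 h
        have : x * y = x * m + N * (x * t) := by linear_combination x * ht
        rw [this, zpow_add₀ hζ0, zpow_mul ζ (N : ℤ), zpow_natCast, hζ.pow_eq_one, one_zpow, mul_one]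
      rw [h3, mul_comm]
    · simp
  rw [Finset.sum_congr rfl h1, Finset.sum_ite_eq', if_pos]
  have hy0 := Int.emod_nonneg y (show (N : ℤ) ≠ 0 by omega)
  have hyN := Int.emod_lt_of_pos y (show (0 : ℤ) < N by omega)
  rw [Finset.mem_range]; omega

theorem qp_add (r : ℕ) (x y : ℂ) : qp r (x + y) = qp r x * qp r y := by
  rw [qp, qp, qp, ← Complex.exp_add]; congr 1; ring

theorem qp_zero (r : ℕ) : qp r 0 = 1 := by simp [qp]

theorem qp_ne_zero (r : ℕ) (x : ℂ) : qp r x ≠ 0 := Complex.exp_ne_zero _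

theorem qp_int_mul (r : ℕ) (m : ℤ) (x : ℂ) : qp r (m * x) = qp r x ^ m := by
  rw [qp, qp, ← Complex.exp_int_mul]; congr 1; ring

theorem qp_nat_mul (r m : ℕ) (x : ℂ) : qp r (m * x) = qp r x ^ m := by
  simpa using qp_int_mul r m x

theorem qp_intCast (r : ℕ) (m : ℤ) : qp r m = qp r 1 ^ m := by
  simpa using qp_int_mul r m 1

theorem isPrimitiveRoot_qp_half {r : ℕ} (hr : 0 < r) : IsPrimitiveRoot (qp r (1 / 2)) (4 * r) := by
  have h := Complex.isPrimitiveRoot_exp (4 * r) (by omega)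
  have hr' : (r : ℂ) ≠ 0 := by exact_mod_cast hr.ne'
  convert h using 1
  rw [qp]; congr 1; push_cast; field_simp; norm_num

theorem qp_half_sq (r : ℕ) : qp r (1 / 2) ^ 2 = qp r 1 := by
  rw [← qp_nat_mul]; norm_num

theorem isPrimitiveRoot_qp_one {r : ℕ} (hr : 0 < r) : IsPrimitiveRoot (qp r 1) (2 * r) := by
  rw [← qp_half_sq]
  exact (isPrimitiveRoot_qp_half hr).pow (by omega) (by ring)

theorem qp_self {r : ℕ} (hr : 0 < r) : qp r r = -1 := by
  have hr' : (r : ℂ) ≠ 0 := by exact_mod_cast hr.ne'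
  rw [qp, mul_div_assoc, div_self hr', mul_one, Complex.exp_pi_mul_I]

theorem qp_one_pow_self {r : ℕ} (hr : 0 < r) : qp r 1 ^ r = -1 := by
  rw [← qp_nat_mul, mul_one, qp_self hr]

theorem qp_neg (r : ℕ) (x : ℂ) : qp r (-x) = (qp r x)⁻¹ := by
  rw [qp, qp, ← Complex.exp_neg]; congr 1; ring

theorem qp_self_sub_one {r : ℕ} (hr : 0 < r) : qp r ((r : ℂ) - 1) = -(qp r 1)⁻¹ := by
  rw [sub_eq_add_neg, qp_add, qp_self hr, qp_neg]; ring

theorem qp_one_pow_ne_one {r m : ℕ} (h0 : 0 < m) (hm : m < 2 * r) : qp r 1 ^ m ≠ 1 :=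
  (isPrimitiveRoot_qp_one (by omega)).pow_ne_one_of_pos_of_lt h0.ne' hm

theorem qp_one_pow_ne_neg_one {r m : ℕ} (hm : m < r) : qp r 1 ^ m ≠ -1 := by
  intro h
  have hr : 0 < r := by omega
  rcases Nat.eq_zero_or_pos m with rfl | h0
  · norm_num at h
  · apply qp_one_pow_ne_one (r := r) (m := 2 * m) (by omega) (by omega)
    rw [mul_comm, pow_mul, h]; norm_num

/-! ### The operators on basis vectors -/

theorem u_of_lt {r m : ℕ} (h : m < r) : u r m = uBasis r ⟨m, h⟩ := dif_pos h

theorem u_of_le {r m : ℕ} (h : r ≤ m) : u r m = 0 := dif_neg (by omega)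

theorem E_u_zero (r : ℕ) : E r (u r 0) = 0 := by
  by_cases h : 0 < r
  · rw [u_of_lt h, E, Module.Basis.constr_basis]; simp
  · rw [u_of_le (by omega), map_zero]

theorem E_u_succ {r m : ℕ} (h : m + 1 < r) : E r (u r (m + 1)) = u r m := by
  rw [u_of_lt h, E, Module.Basis.constr_basis]; simp

theorem k_u (r m : ℕ) : k r (u r m) = qp r (((r : ℂ) - 1 - 2 * m) / 2) • u r m := by
  by_cases h : m < r
  · rw [u_of_lt h, k, Module.Basis.constr_basis, u_of_lt h]
  · rw [u_of_le (by omega), map_zero, smul_zero]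

theorem kInv_u (r m : ℕ) : kInv r (u r m) = qp r (-(((r : ℂ) - 1 - 2 * m) / 2)) • u r m := by
  by_cases h : m < r
  · rw [u_of_lt h, kInv, Module.Basis.constr_basis, u_of_lt h]
  · rw [u_of_le (by omega), map_zero, smul_zero]

theorem k_pow_u (r m t : ℕ) :
    (k r ^ t) (u r m) = qp r (((r : ℂ) - 1 - 2 * m) / 2) ^ t • u r m := by
  induction t with
  | zero => simp
  | succ t ih => rw [pow_succ', Module.End.mul_apply, ih, map_smul, k_u, smul_smul, pow_succ]

/-- By $q^r=-1$ the eigenvalues of $k^{2}$ become signed integral powers of $q$; no half-integral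
power enters the coproducts. -/
theorem qp_weight {r : ℕ} (hr : 0 < r) (m : ℕ) :
    qp r (((r : ℂ) - 1 - 2 * m) / 2) ^ 2 = -(qp r 1)⁻¹ ^ (2 * m + 1) := by
  rw [← qp_nat_mul]
  have : ((2 : ℕ) : ℂ) * (((r : ℂ) - 1 - 2 * m) / 2) = r + ((2 * m + 1 : ℕ) : ℂ) * (-1) := by
    push_cast; ring
  rw [this, qp_add, qp_self hr, qp_nat_mul, qp_neg]; ring

theorem k_sq_u {r : ℕ} (hr : 0 < r) (m : ℕ) :
    (k r ^ 2) (u r m) = (-(qp r 1)⁻¹ ^ (2 * m + 1)) • u r m := by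
  rw [k_pow_u, qp_weight hr]

theorem kInv_sq_u {r : ℕ} (hr : 0 < r) (m : ℕ) :
    (kInv r ^ 2) (u r m) = (-(qp r 1) ^ (2 * m + 1)) • u r m := by
  rw [pow_two, Module.End.mul_apply, kInv_u, map_smul, kInv_u, smul_smul, ← pow_two, qp_neg, inv_pow,
    qp_weight hr]
  congr 1
  rw [inv_pow, ← neg_inv, inv_inv]

theorem qp_one_sq_ne_one {r : ℕ} (hr : 2 ≤ r) : qp r 1 ^ 2 ≠ 1 :=
  qp_one_pow_ne_one (by omega) (by omega)

theorem qnum_one_ne_zero {r : ℕ} (hr : 2 ≤ r) : qnum r 1 ≠ 0 := by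
  intro h
  rw [qnum, qp_neg, sub_eq_zero] at h
  apply qp_one_sq_ne_one hr
  have := qp_ne_zero r 1
  field_simp at h
  exact h

theorem qint_one {r : ℕ} (hr : 2 ≤ r) : qint r 1 = 1 := div_self (qnum_one_ne_zero hr)

theorem qint_two {r : ℕ} (hr : 2 ≤ r) : qint r 2 = qp r 1 + (qp r 1)⁻¹ := by
  have h0 := qp_ne_zero r 1
  have h1 := qnum_one_ne_zero hr
  rw [qint, div_eq_iff h1, qnum, qnum, qp_neg, qp_neg]
  have : qp r 2 = qp r 1 ^ 2 := by rw [← qp_nat_mul]; norm_num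
  rw [this]; field_simp; ring

/-- A consequence of $q^r=-1$; it turns the coefficient $[m+1][r-1-m]$ of $F$ into $[m+1]^2$. -/
theorem qint_self_sub {r : ℕ} (hr : 0 < r) (x : ℂ) : qint r ((r : ℂ) - x) = qint r x := by
  have h1 : qp r ((r : ℂ) - x) = -(qp r x)⁻¹ := by
    rw [sub_eq_add_neg, qp_add, qp_self hr, qp_neg]; ring
  simp only [qint, qnum]
  rw [qp_neg r (r - x), h1, qp_neg r x, ← inv_neg, inv_inv]
  congr 1
  rw [inv_neg]; ring

theorem F_u {r m : ℕ} (h : m < r) : F r (u r m) = qint r (m + 1) ^ 2 • u r (m + 1) := by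
  rw [u_of_lt h, F, Module.Basis.constr_basis]
  have h1 : (r : ℂ) - 1 - m = r - (m + 1) := by ring
  simp only [h1, qint_self_sub (show 0 < r by omega), pow_two]

/-! ### Elementary tensors with two or three distinguished factors -/

/-- The elementary tensor with factors `x` at `i`, `y` at `j`, and `f l` at the other `l`. -/
def place {r n : ℕ} (f : Fin n → V r) (i j : Fin n) (x y : V r) : VT r n :=
  PiTensorProduct.tprod ℂ (update (update f i x) j y)

section place

variable {r n : ℕ} (f : Fin n → V r) {i j : Fin n}

theorem place_smul_left (hij : i ≠ j) (c : ℂ) (x y : V r) :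
    place f i j (c • x) y = c • place f i j x y := by
  simp only [place, update_comm hij]
  exact MultilinearMap.map_update_smul _ _ _ _ _

theorem place_smul_right (c : ℂ) (x y : V r) :
    place f i j x (c • y) = c • place f i j x y :=
  MultilinearMap.map_update_smul _ _ _ _ _

theorem place_zero_left (hij : i ≠ j) (y : V r) : place f i j 0 y = 0 := by
  simpa using place_smul_left f hij 0 0 y

theorem place_zero_right (x : V r) : place f i j x 0 = 0 := by
  simpa using place_smul_right f (i := i) (j := j) 0 x 0

theorem map_place (hij : i ≠ j) (g : Fin n → Module.End ℂ (V r)) (x y : V r) :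
    PiTensorProduct.map g (place f i j x y) = place (fun l => g l (f l)) i j (g i x) (g j y) := by
  rw [place, place, PiTensorProduct.map_tprod]
  congr 1
  funext l
  by_cases hj : l = j
  · subst hj; simp
  · by_cases hi : l = i
    · subst hi; simp [hj]
    · simp [hi, hj]

theorem place_congr {f f' : Fin n → V r} (h : ∀ l, l ≠ i → l ≠ j → f l = f' l) (x y : V r) :
    place f i j x y = place f' i j x y := by
  rw [place, place]
  congr 1
  funext l
  by_cases hj : l = j
  · subst hj; simp
  · by_cases hi : l = i
    · subst hi; simp [hj]
    · simp [hi, hj, h l hi hj]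

theorem place_self {x y : V r} (hx : f i = x) (hy : f j = y) :
    place f i j x y = PiTensorProduct.tprod ℂ f := by
  subst hx hy; simp [place]

theorem twoSite_place (hij : i ≠ j) (A B : Module.End ℂ (V r)) (x y : V r) :
    twoSite i j A B (place f i j x y) = place f i j (A x) (B y) := by
  rw [twoSite, map_place f hij]
  simp only [if_true, if_neg hij.symm]
  exact place_congr (fun l hi hj => by simp [hi, hj]) _ _

theorem flipOp_place (hij : i ≠ j) (x y : V r) :
    flipOp r n i j (place f i j x y) = place f i j y x := by
  rw [flipOp, place, place, LinearEquiv.coe_coe, PiTensorProduct.reindex_tprod]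
  congr 1
  funext l
  by_cases hj : l = j
  · subst hj; simp [hij]
  · by_cases hi : l = i
    · subst hi; simp [hj]
    · simp [hi, hj, Equiv.swap_apply_of_ne_of_ne hi hj]

/-- The Cartan part of the `R`-matrix is evaluated by a Gaussian sum. -/
theorem RMat_place (hr : 0 < r) (hij : i ≠ j) (b c : ℕ) :
    RMat r n i j (place f i j (u r b) (u r c)) = ∑ a ∈ Finset.range r,
      (qnum r 1 ^ (2 * a) / qnumFact r a * (qp r ((a : ℂ) * ((a : ℂ) - 1) / 2) *
        qp r (1 / 2) ^ (((r : ℤ) - 1 - 2 * b + 2 * a) * ((r : ℤ) - 1 - 2 * c - 2 * a)))) •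
        place f i j ((E r ^ a) (u r b)) ((F r ^ a) (u r c)) := by
  have hr' : (4 * (r : ℂ)) ≠ 0 := by simp; omega
  rw [RMat, LinearMap.smul_apply, LinearMap.sum_apply, Finset.smul_sum]
  refine Finset.sum_congr rfl fun a _ => ?_
  simp only [LinearMap.sum_apply, LinearMap.smul_apply, twoSite_place f hij, Module.End.mul_apply,
    k_pow_u, map_smul, place_smul_left f hij, place_smul_right, smul_smul, ← Finset.sum_smul]
  congr 1
  have hg := sum_sum_zpow_sub_mul (by omega) (isPrimitiveRoot_qp_half hr)
    ((r : ℤ) - 1 - 2 * b + 2 * a) ((r : ℤ) - 1 - 2 * c - 2 * a)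
  -- The factor $q^{a(m-m')}$ shifts the weights of $u_b$ and $u_c$ to those of $E^au_b$ and
  -- $F^au_c$, which become the two linear coefficients of the Gaussian sum.
  have hterm : ∀ m m' : ℕ, qp r ((a : ℂ) * ((a : ℂ) - 1) / 2 + (a : ℂ) * ((m : ℂ) - (m' : ℂ))
      - (m : ℂ) * (m' : ℂ) / 2) * qp r (((r : ℂ) - 1 - 2 * b) / 2) ^ m *
        qp r (((r : ℂ) - 1 - 2 * c) / 2) ^ m' = qp r ((a : ℂ) * ((a : ℂ) - 1) / 2) *
      qp r (1 / 2) ^ (((r : ℤ) - 1 - 2 * b + 2 * a) * (m : ℤ) +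
        ((r : ℤ) - 1 - 2 * c - 2 * a) * (m' : ℤ) - m * m') := by
    intro m m'
    rw [← qp_nat_mul, ← qp_nat_mul, ← qp_int_mul, ← qp_add, ← qp_add, ← qp_add]
    congr 1; push_cast; ring
  generalize qnum r 1 ^ (2 * a) / qnumFact r a = P
  calc _ = 1 / (4 * (r : ℂ)) * ∑ m ∈ Finset.range (4 * r), ∑ m' ∈ Finset.range (4 * r),
        P * qp r ((a : ℂ) * ((a : ℂ) - 1) / 2) * qp r (1 / 2) ^ (((r : ℤ) - 1 - 2 * b + 2 * a) *
          (m : ℤ) + ((r : ℤ) - 1 - 2 * c - 2 * a) * (m' : ℤ) - m * m') := by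
        congr 1
        refine Finset.sum_congr rfl fun m _ => Finset.sum_congr rfl fun m' _ => ?_
        linear_combination P * hterm m m'
    _ = _ := by
        simp only [← Finset.mul_sum, hg]
        have hr1 : (r : ℂ) ≠ 0 := right_ne_zero_of_mul hr'
        push_cast
        field_simp

end place

/-! ### The braid operator on local weights at most two -/

/-- The action of the normalized `R`-matrix, composed with the flip, on the vectors
`u_b ⊗ u_c` with `b + c ≤ 2`. -/
structure BraidRules {M : Type*} [AddCommGroup M] [Module ℂ M] (q : ℂ) (S : Module.End ℂ M)
    (g : ℕ → ℕ → M) : Prop where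
  h00 : S (g 0 0) = g 0 0
  h01 : S (g 0 1) = (-q) • g 1 0
  h10 : S (g 1 0) = (-q) • g 0 1 + (1 - q ^ 2) • g 1 0
  h02 : S (g 0 2) = q ^ 2 • g 2 0
  h11 : S (g 1 1) = q ^ 4 • g 1 1 + (q⁻¹ * (q ^ 2 - 1) * (q ^ 2 + 1) ^ 2) • g 2 0
  h20 : S (g 2 0) = q ^ 2 • g 0 2 + (q ^ 3 * (q ^ 2 - 1)) • g 1 1 +
    ((q ^ 2 - 1) * (q ^ 4 - 1)) • g 2 0

theorem qp_one_zpow_sub_one {r : ℕ} (hr : 0 < r) : qp r 1 ^ ((r : ℤ) - 1) = -(qp r 1)⁻¹ := by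
  rw [← qp_intCast]; push_cast; exact qp_self_sub_one hr

/-- The normalization cancels $q^{(r-1)^2/2}$, and $q^{-(r-1)}=-q$ makes the remaining exponent
integral. -/
theorem braid_exponent {r : ℕ} (hr : 0 < r) (a b c : ℕ) :
    qp r (-((r : ℂ) - 1) ^ 2 / 2) *
      qp r (1 / 2) ^ (((r : ℤ) - 1 - 2 * b + 2 * a) * ((r : ℤ) - 1 - 2 * c - 2 * a)) =
    (-qp r 1) ^ (b + c) * qp r 1 ^ (2 * ((b : ℤ) - a) * (c + a)) := by
  have h0 := qp_ne_zero r (1 / 2)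
  have h1 : (-qp r 1) ^ (b + c) = qp r 1 ^ (-((r : ℤ) - 1) * ((b + c : ℕ) : ℤ)) := by
    rw [zpow_mul, zpow_neg, qp_one_zpow_sub_one hr, zpow_natCast, inv_neg, inv_inv]
  have h2 : qp r (-((r : ℂ) - 1) ^ 2 / 2) = qp r (1 / 2) ^ (-((r : ℤ) - 1) ^ 2) := by
    rw [← qp_int_mul]; congr 1; push_cast; ring
  rw [h1, h2, ← qp_half_sq, ← zpow_natCast _ 2, ← zpow_mul, ← zpow_mul, ← zpow_add₀ h0,
    ← zpow_add₀ h0]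
  congr 1; push_cast; ring

section local_rules

variable {r n : ℕ}

theorem F_u_zero (hr : 2 ≤ r) : F r (u r 0) = u r 1 := by
  rw [F_u (by omega)]; simp [qint_one hr]

theorem F_u_one (hr : 2 ≤ r) : F r (u r 1) = (qp r 1 + (qp r 1)⁻¹) ^ 2 • u r 2 := by
  rw [F_u (by omega), ← qint_two hr]; norm_num

theorem qnum_one_eq (r : ℕ) : qnum r 1 = qp r 1 - (qp r 1)⁻¹ := by rw [qnum, qp_neg]

theorem qnum_two_eq (r : ℕ) : qnum r 2 = qp r 1 ^ 2 - (qp r 1 ^ 2)⁻¹ := by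
  rw [qnum, qp_neg, ← qp_nat_mul]; norm_num

theorem braidOp_place (hr : 0 < r) (f : Fin n → V r) (i : Fin (n - 1)) {i₀ i₁ : Fin n}
    (h₀ : (i₀ : ℕ) = i) (h₁ : (i₁ : ℕ) = i + 1) (b c : ℕ) :
    braidOp r n i (place f i₀ i₁ (u r b) (u r c)) = ∑ a ∈ Finset.range r,
      (qnum r 1 ^ (2 * a) / qnumFact r a * qp r ((a : ℂ) * ((a : ℂ) - 1) / 2) *
        ((-qp r 1) ^ (b + c) * qp r 1 ^ (2 * ((b : ℤ) - a) * (c + a)))) •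
        place f i₀ i₁ ((F r ^ a) (u r c)) ((E r ^ a) (u r b)) := by
  have hij : i₀ ≠ i₁ := fun h => by rw [h] at h₀; omega
  have e₀ : (⟨i, by omega⟩ : Fin n) = i₀ := Fin.ext h₀.symm
  have e₁ : (⟨i + 1, by omega⟩ : Fin n) = i₁ := Fin.ext h₁.symm
  rw [braidOp]
  simp only [e₀, e₁, LinearMap.smul_apply, LinearMap.comp_apply, RMat_place f hr hij, map_sum, map_smul,
    flipOp_place f hij, Finset.smul_sum, smul_smul, ← braid_exponent hr]
  refine Finset.sum_congr rfl fun a _ => ?_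
  congr 1; ring

theorem braidRules_place (hr : 5 ≤ r) (f : Fin n → V r) (i : Fin (n - 1)) {i₀ i₁ : Fin n}
    (h₀ : (i₀ : ℕ) = i) (h₁ : (i₁ : ℕ) = i + 1) :
    BraidRules (qp r 1) (braidOp r n i) (fun b c => place f i₀ i₁ (u r b) (u r c)) := by
  have hij : i₀ ≠ i₁ := fun h => by rw [h] at h₀; omega
  have hE0 := E_u_zero r
  have hE1 : E r (u r 1) = u r 0 := E_u_succ (by omega)
  have hE2 : E r (u r 2) = u r 1 := E_u_succ (by omega)
  have hF0 := F_u_zero (r := r) (by omega)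
  have hF1 := F_u_one (r := r) (by omega)
  have hq := qp_ne_zero r 1
  have hz : qp r 1 ^ 2 - 1 ≠ 0 := sub_ne_zero.2 (qp_one_sq_ne_one (by omega))
  have hz1 : qp r 1 ^ 2 + 1 ≠ 0 := fun h =>
    qp_one_pow_ne_neg_one (r := r) (m := 2) (by omega) (eq_neg_of_add_eq_zero_left h)
  -- The sum over `a` stops at 2, because $E^3$ kills $u_0,u_1,u_2$.
  have key : ∀ b c : ℕ, b ≤ 2 → braidOp r n i (place f i₀ i₁ (u r b) (u r c)) =
      ∑ a ∈ Finset.range 3,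
      (qnum r 1 ^ (2 * a) / qnumFact r a * qp r ((a : ℂ) * ((a : ℂ) - 1) / 2) *
        ((-qp r 1) ^ (b + c) * qp r 1 ^ (2 * ((b : ℤ) - a) * (c + a)))) •
        place f i₀ i₁ ((F r ^ a) (u r c)) ((E r ^ a) (u r b)) := by
    intro b c hb
    rw [braidOp_place (by omega) f i h₀ h₁]
    symm
    refine Finset.sum_subset (Finset.range_mono (by omega)) fun a _ ha => ?_
    have h3 : (E r ^ a) (u r b) = 0 := by
      obtain ⟨t, rfl⟩ : ∃ t, a = t + 3 := ⟨a - 3, by simp at ha; omega⟩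
      rw [pow_add, Module.End.mul_apply]
      interval_cases b <;> simp [pow_succ, hE0, hE1, hE2]
    rw [h3, place_zero_right, smul_zero]
  have hE0' : (E r ^ 2) (u r 0) = 0 := by simp [pow_two, hE0]
  have hE1' : (E r ^ 2) (u r 1) = 0 := by simp [pow_two, hE0, hE1]
  have hE2' : (E r ^ 2) (u r 2) = u r 0 := by simp [pow_two, hE2, hE1]
  have hF0' : (F r ^ 2) (u r 0) = (qp r 1 + (qp r 1)⁻¹) ^ 2 • u r 2 := by simp [pow_two, hF0, hF1]
  constructor <;>
  simp only [key _ _ (show 0 ≤ 2 by omega), key _ _ (show 1 ≤ 2 by omega), key _ _ le_rfl,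
    Finset.sum_range_succ, Finset.sum_range_zero, pow_zero, pow_one, hE0, hE1, hE2, hE0', hE1',
    hE2', hF0, hF1, hF0', place_zero_right, Module.End.one_apply, smul_zero, qnumFact,
    Finset.prod_range_succ, Finset.prod_range_zero, place_smul_left f hij, smul_smul] <;>
  norm_num [qp_zero, qnum_one_eq, qnum_two_eq]
  all_goals
    generalize qp r 1 = q at *
    have e1 : q - q⁻¹ = (q ^ 2 - 1) / q := by field_simp
    have e2 : q ^ 2 - (q ^ 2)⁻¹ = (q ^ 2 - 1) * (q ^ 2 + 1) / q ^ 2 := by field_simp; ring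
    rw [e1]
  · rw [← neg_smul]
    congr 1
    field_simp
    ring
  · congr 2
    · ring
    · field_simp
  · rw [e2]
    refine congrArg₂ (· + ·) (congrArg₂ (· + ·) rfl (congrArg (· • _) ?_)) (congrArg (· • _) ?_)
    · field_simp
    · field_simp
      ring

end local_rules

/-! ### Consequences of the local rules -/

namespace BraidRules

variable {M : Type*} [AddCommGroup M] [Module ℂ M] {q : ℂ}

/-- The blocks `b + c = 0, 1, 2` have eigenvalues $\{1\}$, $\{1,-q^2\}$ and $\{1,-q^2,q^6\}$
respectively. -/
theorem cubic_apply {S : Module.End ℂ M} {g : ℕ → ℕ → M} (hq : q ≠ 0) (h : BraidRules q S g)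
    {b c : ℕ} (hbc : b + c ≤ 2) :
    ((S - 1) * (S + algebraMap ℂ _ (q ^ 2)) * (S - algebraMap ℂ _ (q ^ 6))) (g b c) = 0 := by
  obtain ⟨h00, h01, h10, h02, h11, h20⟩ := h
  obtain ⟨rfl, rfl⟩ | ⟨rfl, rfl⟩ | ⟨rfl, rfl⟩ | ⟨rfl, rfl⟩ | ⟨rfl, rfl⟩ | ⟨rfl, rfl⟩ :
    (b = 0 ∧ c = 0) ∨ (b = 0 ∧ c = 1) ∨ (b = 1 ∧ c = 0) ∨ (b = 0 ∧ c = 2) ∨ (b = 1 ∧ c = 1) ∨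
      (b = 2 ∧ c = 0) := by omega
  all_goals
    simp only [Module.End.mul_apply, LinearMap.sub_apply, LinearMap.add_apply,
      Module.algebraMap_end_apply, Module.End.one_apply, h00, h01, h10, h02, h11, h20, map_add,
      map_sub, map_smul]
    match_scalars <;> field_simp <;> ring

/-- The Yang–Baxter equation is checked directly on the ten vectors of weight at most 2; the third
index is a spectator for `S`, the first for `T`. -/
theorem braid_apply {S T : Module.End ℂ M} {G : ℕ → ℕ → ℕ → M} (hq : q ≠ 0)
    (hS : ∀ d, BraidRules q S fun b c => G b c d) (hT : ∀ b, BraidRules q T fun c d => G b c d)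
    {b c d : ℕ} (hbcd : b + c + d ≤ 2) :
    S (T (S (G b c d))) = T (S (T (G b c d))) := by
  have s00 := fun d => (hS d).h00
  have s01 := fun d => (hS d).h01
  have s10 := fun d => (hS d).h10
  have s02 := fun d => (hS d).h02
  have s11 := fun d => (hS d).h11
  have s20 := fun d => (hS d).h20
  have t00 := fun d => (hT d).h00
  have t01 := fun d => (hT d).h01
  have t10 := fun d => (hT d).h10
  have t02 := fun d => (hT d).h02
  have t11 := fun d => (hT d).h11
  have t20 := fun d => (hT d).h20
  obtain ⟨rfl, rfl, rfl⟩ | ⟨rfl, rfl, rfl⟩ | ⟨rfl, rfl, rfl⟩ | ⟨rfl, rfl, rfl⟩ | ⟨rfl, rfl, rfl⟩ |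
    ⟨rfl, rfl, rfl⟩ | ⟨rfl, rfl, rfl⟩ | ⟨rfl, rfl, rfl⟩ | ⟨rfl, rfl, rfl⟩ | ⟨rfl, rfl, rfl⟩ :
    (b = 0 ∧ c = 0 ∧ d = 0) ∨ (b = 0 ∧ c = 0 ∧ d = 1) ∨ (b = 0 ∧ c = 1 ∧ d = 0) ∨
    (b = 1 ∧ c = 0 ∧ d = 0) ∨ (b = 0 ∧ c = 0 ∧ d = 2) ∨ (b = 0 ∧ c = 1 ∧ d = 1) ∨
    (b = 0 ∧ c = 2 ∧ d = 0) ∨ (b = 1 ∧ c = 0 ∧ d = 1) ∨ (b = 1 ∧ c = 1 ∧ d = 0) ∨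
    (b = 2 ∧ c = 0 ∧ d = 0) := by omega
  all_goals
    simp only [s00, s01, s10, s02, s11, s20, t00, t01, t10, t02, t11, t20, map_add, map_smul]
    try (match_scalars <;> field_simp <;> ring)

theorem commute_apply {S T : Module.End ℂ M} {G : ℕ → ℕ → ℕ → ℕ → M}
    (hS : ∀ c d, BraidRules q S fun a b => G a b c d)
    (hT : ∀ a b, BraidRules q T fun c d => G a b c d)
    {a b c d : ℕ} (hab : a + b ≤ 2) (hcd : c + d ≤ 2) :
    S (T (G a b c d)) = T (S (G a b c d)) := by
  have s00 := fun c d => (hS c d).h00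
  have s01 := fun c d => (hS c d).h01
  have s10 := fun c d => (hS c d).h10
  have s02 := fun c d => (hS c d).h02
  have s11 := fun c d => (hS c d).h11
  have s20 := fun c d => (hS c d).h20
  have t00 := fun c d => (hT c d).h00
  have t01 := fun c d => (hT c d).h01
  have t10 := fun c d => (hT c d).h10
  have t02 := fun c d => (hT c d).h02
  have t11 := fun c d => (hT c d).h11
  have t20 := fun c d => (hT c d).h20
  have cases6 : ∀ b c : ℕ, b + c ≤ 2 → (b = 0 ∧ c = 0) ∨ (b = 0 ∧ c = 1) ∨ (b = 1 ∧ c = 0) ∨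
    (b = 0 ∧ c = 2) ∨ (b = 1 ∧ c = 1) ∨ (b = 2 ∧ c = 0) := by omega
  obtain ⟨rfl, rfl⟩ | ⟨rfl, rfl⟩ | ⟨rfl, rfl⟩ | ⟨rfl, rfl⟩ | ⟨rfl, rfl⟩ | ⟨rfl, rfl⟩ :=
    cases6 a b hab <;>
  obtain ⟨rfl, rfl⟩ | ⟨rfl, rfl⟩ | ⟨rfl, rfl⟩ | ⟨rfl, rfl⟩ | ⟨rfl, rfl⟩ | ⟨rfl, rfl⟩ :=
    cases6 c d hcd <;>
  · simp only [s00, s01, s10, s02, s11, s20, t00, t01, t10, t02, t11, t20, map_add, map_smul]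
    try module

/-- Compatibility with the coproduct `1 ⊗ E + E ⊗ k²`. -/
theorem lower_apply {S D : Module.End ℂ M} {g g' : ℕ → ℕ → M} (hq : q ≠ 0) (h : BraidRules q S g)
    (h' : BraidRules q S g')
    (hD : ∀ b c, b + c ≤ 2 → D (g b c) = (if b = 0 then 0 else (-q⁻¹ ^ (2 * c + 1)) • g' (b - 1) c)
      + if c = 0 then 0 else g' b (c - 1))
    {b c : ℕ} (hbc : b + c ≤ 2) : D (S (g b c)) = S (D (g b c)) := by
  have d00 := hD 0 0 (by omega)
  have d01 := hD 0 1 (by omega)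
  have d10 := hD 1 0 (by omega)
  have d02 := hD 0 2 (by omega)
  have d11 := hD 1 1 (by omega)
  have d20 := hD 2 0 (by omega)
  norm_num at d00 d01 d10 d02 d11 d20
  obtain ⟨h00, h01, h10, h02, h11, h20⟩ := h
  obtain ⟨k00, k01, k10, k02, k11, k20⟩ := h'
  obtain ⟨rfl, rfl⟩ | ⟨rfl, rfl⟩ | ⟨rfl, rfl⟩ | ⟨rfl, rfl⟩ | ⟨rfl, rfl⟩ | ⟨rfl, rfl⟩ :
    (b = 0 ∧ c = 0) ∨ (b = 0 ∧ c = 1) ∨ (b = 1 ∧ c = 0) ∨ (b = 0 ∧ c = 2) ∨ (b = 1 ∧ c = 1) ∨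
      (b = 2 ∧ c = 0) := by omega
  all_goals
    simp only [h00, h01, h10, h02, h11, h20, k00, k01, k10, d00, d01, d10, d02, d11, d20,
      map_add, map_smul, map_zero, map_neg]
  all_goals try match_scalars <;> field_simp <;> ring

/-- Compatibility with the coproduct `k⁻² ⊗ F + F ⊗ 1`. -/
theorem raise_apply {S D : Module.End ℂ M} {g g' : ℕ → ℕ → M} {φ : ℕ → ℂ} (hq : q ≠ 0)
    (h : BraidRules q S g) (h' : BraidRules q S g') (hφ0 : φ 0 = 1) (hφ1 : φ 1 = (q + q⁻¹) ^ 2)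
    (hD : ∀ b c, b + c ≤ 1 → D (g b c) = φ b • g' (b + 1) c +
      (-q ^ (2 * b + 1) * φ c) • g' b (c + 1))
    {b c : ℕ} (hbc : b + c ≤ 1) : D (S (g b c)) = S (D (g b c)) := by
  have d00 := hD 0 0 (by omega)
  have d01 := hD 0 1 (by omega)
  have d10 := hD 1 0 (by omega)
  simp only [hφ0, hφ1] at d00 d01 d10
  norm_num at d00 d01 d10
  obtain ⟨h00, h01, h10, h02, h11, h20⟩ := h
  obtain ⟨k00, k01, k10, k02, k11, k20⟩ := h'
  obtain ⟨rfl, rfl⟩ | ⟨rfl, rfl⟩ | ⟨rfl, rfl⟩ :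
    (b = 0 ∧ c = 0) ∨ (b = 0 ∧ c = 1) ∨ (b = 1 ∧ c = 0) := by omega
  all_goals
    simp only [h00, h01, h10, k01, k10, k02, k11, k20, d00, d01, d10, map_add, map_smul, map_neg]
    match_scalars <;> field_simp <;> ring

/-- `S` preserves `b + c`, so it commutes with a `D` whose scalar depends only on `b + c`. This
serves the summands of $E$ and $F$ located at other strands; `g'` differs from `g` in the spectator
factors, on which `D` also acts. -/
theorem diag_apply {S D : Module.End ℂ M} {g g' : ℕ → ℕ → M} (h : BraidRules q S g)
    (h' : BraidRules q S g') {μ : ℕ → ℂ} (hD : ∀ b c, D (g b c) = μ (b + c) • g' b c)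
    {b c : ℕ} (hbc : b + c ≤ 2) : D (S (g b c)) = S (D (g b c)) := by
  obtain ⟨h00, h01, h10, h02, h11, h20⟩ := h
  obtain ⟨k00, k01, k10, k02, k11, k20⟩ := h'
  obtain ⟨rfl, rfl⟩ | ⟨rfl, rfl⟩ | ⟨rfl, rfl⟩ | ⟨rfl, rfl⟩ | ⟨rfl, rfl⟩ | ⟨rfl, rfl⟩ :
    (b = 0 ∧ c = 0) ∨ (b = 0 ∧ c = 1) ∨ (b = 1 ∧ c = 0) ∨ (b = 0 ∧ c = 2) ∨ (b = 1 ∧ c = 1) ∨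
      (b = 2 ∧ c = 0) := by omega
  all_goals
    simp only [h00, h01, h10, h02, h11, h20, k00, k01, k10, k02, k11, k20, hD, map_add, map_smul]
    try module

theorem apply_mem {S : Module.End ℂ M} {g : ℕ → ℕ → M} (h : BraidRules q S g)
    {W : Submodule ℂ M} {b c : ℕ} (hbc : b + c ≤ 2)
    (hW : ∀ b' c', b' + c' = b + c → g b' c' ∈ W) : S (g b c) ∈ W := by
  obtain ⟨h00, h01, h10, h02, h11, h20⟩ := h
  obtain ⟨rfl, rfl⟩ | ⟨rfl, rfl⟩ | ⟨rfl, rfl⟩ | ⟨rfl, rfl⟩ | ⟨rfl, rfl⟩ | ⟨rfl, rfl⟩ :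
    (b = 0 ∧ c = 0) ∨ (b = 0 ∧ c = 1) ∨ (b = 1 ∧ c = 0) ∨ (b = 0 ∧ c = 2) ∨ (b = 1 ∧ c = 1) ∨
      (b = 2 ∧ c = 0) := by omega
  · rw [h00]; exact hW _ _ rfl
  · rw [h01]; exact W.smul_mem _ (hW _ _ rfl)
  · rw [h10]; exact W.add_mem (W.smul_mem _ (hW _ _ rfl)) (W.smul_mem _ (hW _ _ rfl))
  · rw [h02]; exact W.smul_mem _ (hW _ _ rfl)
  · rw [h11]; exact W.add_mem (W.smul_mem _ (hW _ _ rfl)) (W.smul_mem _ (hW _ _ rfl))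
  · rw [h20]
    exact W.add_mem (W.add_mem (W.smul_mem _ (hW _ _ rfl)) (W.smul_mem _ (hW _ _ rfl)))
      (W.smul_mem _ (hW _ _ rfl))

end BraidRules

/-! ### Weight spaces -/

section weight

variable {r n : ℕ}

/-- Since `u r m = 0` for `m ≥ r`, exponents may range over `ℕ` with no bound to carry along. -/
theorem tprod_u_mem_weightSpace {ε : Fin n → ℕ} {l : ℕ} (h : ∑ i, ε i = l) :
    PiTensorProduct.tprod ℂ (fun i => u r (ε i)) ∈ weightSpace r n l := by
  by_cases hε : ∀ i, ε i < r
  · exact Submodule.subset_span ⟨fun i => ⟨ε i, hε i⟩, h, rfl⟩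
  · push Not at hε
    obtain ⟨i, hi⟩ := hε
    rw [MultilinearMap.map_coord_zero _ i (u_of_le hi)]
    exact Submodule.zero_mem _

theorem tprod_mem_weightSpace {x : Fin n → V r} {ε : Fin n → ℕ} {l : ℕ} (h : ∑ i, ε i = l)
    (hx : ∀ i, ∃ c : ℂ, x i = c • u r (ε i)) :
    PiTensorProduct.tprod ℂ x ∈ weightSpace r n l := by
  choose c hc using hx
  rw [funext hc, MultilinearMap.map_smul_univ]
  exact Submodule.smul_mem _ _ (tprod_u_mem_weightSpace h)

theorem sum_update_add_apply {ι : Type*} [Fintype ι] [DecidableEq ι] (ε : ι → ℕ) (i : ι) (b : ℕ) :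
    ∑ l, update ε i b l + ε i = ∑ l, ε l + b := by
  rw [Finset.sum_update_of_mem (Finset.mem_univ i), add_assoc,
    ← Finset.sum_singleton ε i, Finset.sum_sdiff (Finset.subset_univ {i}), add_comm]

/-- The weight condition is stated additively to avoid truncated subtraction. -/
theorem place_mem_weightSpace {ε : Fin n → ℕ} {i j : Fin n} (hij : i ≠ j) {b c l : ℕ}
    (h : ∑ i, ε i + b + c = l + ε i + ε j) :
    place (fun l => u r (ε l)) i j (u r b) (u r c) ∈ weightSpace r n l := by
  have h1 := sum_update_add_apply ε i b
  have h2 := sum_update_add_apply (update ε i b) j c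
  rw [update_of_ne hij.symm] at h2
  have : place (fun l => u r (ε l)) i j (u r b) (u r c) =
      PiTensorProduct.tprod ℂ (fun l => u r (update (update ε i b) j c l)) := by
    rw [place]; congr 1; funext l
    by_cases hj : l = j
    · subst hj; simp
    · by_cases hi : l = i
      · subst hi; simp [hj]
      · simp [hi, hj]
  rw [this]
  exact tprod_u_mem_weightSpace (by omega)

theorem weightSpace_le_comap {l l' : ℕ} {T : Module.End ℂ (VT r n)}
    (h : ∀ ε : Fin n → ℕ, (∀ i, ε i < r) → ∑ i, ε i = l →
      T (PiTensorProduct.tprod ℂ fun i => u r (ε i)) ∈ weightSpace r n l') :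
    ∀ w ∈ weightSpace r n l, T w ∈ weightSpace r n l' := by
  intro w hw
  refine (Submodule.span_le (p := (weightSpace r n l').comap T)).2 ?_ hw
  rintro _ ⟨ε, hε, rfl⟩
  exact h (fun i => ε i) (fun i => (ε i).2) hε

theorem eq_on_weightSpace {M : Type*} [AddCommGroup M] [Module ℂ M] {l : ℕ} {S T : VT r n →ₗ[ℂ] M}
    (h : ∀ ε : Fin n → ℕ, ∑ i, ε i = l → S (PiTensorProduct.tprod ℂ fun i => u r (ε i)) =
      T (PiTensorProduct.tprod ℂ fun i => u r (ε i))) :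
    ∀ w ∈ weightSpace r n l, S w = T w := by
  intro w hw
  refine LinearMap.eqOn_span (s := _) ?_ hw
  rintro _ ⟨ε, hε, rfl⟩
  exact h (fun i => ε i) hε

theorem apply_add_apply_le_sum {ι : Type*} [Fintype ι] [DecidableEq ι] (ε : ι → ℕ) {i j : ι}
    (hij : i ≠ j) : ε i + ε j ≤ ∑ l, ε l := by
  rw [← Finset.sum_pair hij]
  exact Finset.sum_le_univ_sum_of_nonneg fun _ => Nat.zero_le _

theorem ET_mem_weightSpace (hr : 0 < r) {l : ℕ} :
    ∀ w ∈ weightSpace r n (l + 1), ET r n w ∈ weightSpace r n l := by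
  refine weightSpace_le_comap fun ε hεr hε => ?_
  rw [ET, LinearMap.sum_apply]
  refine Submodule.sum_mem _ fun i _ => ?_
  rw [PiTensorProduct.map_tprod]
  rcases Nat.eq_zero_or_eq_succ_pred (ε i) with h0 | h0
  · rw [MultilinearMap.map_coord_zero _ i (by simp [h0, E_u_zero])]
    exact Submodule.zero_mem _
  · have hs := sum_update_add_apply ε i (ε i - 1)
    refine tprod_mem_weightSpace (ε := update ε i (ε i - 1)) (by omega) fun j => ?_
    rcases lt_trichotomy j i with h | h | h
    · exact ⟨1, by simp [h, h.ne]⟩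
    · subst h
      refine ⟨1, ?_⟩
      have := E_u_succ (r := r) (m := ε j - 1) (by have := hεr j; omega)
      rw [show ε j - 1 + 1 = ε j by omega] at this
      simp [this]
    · exact ⟨-(qp r 1)⁻¹ ^ (2 * ε j + 1), by simp only [h.not_gt, h.ne', if_false,
        k_sq_u hr, update_of_ne h.ne']⟩

theorem FT_mem_weightSpace (hr : 0 < r) {l : ℕ} :
    ∀ w ∈ weightSpace r n l, FT r n w ∈ weightSpace r n (l + 1) := by
  refine weightSpace_le_comap fun ε hεr hε => ?_
  rw [FT, LinearMap.sum_apply]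
  refine Submodule.sum_mem _ fun i _ => ?_
  rw [PiTensorProduct.map_tprod]
  have hs := sum_update_add_apply ε i (ε i + 1)
  refine tprod_mem_weightSpace (ε := update ε i (ε i + 1)) (by omega) fun j => ?_
  rcases lt_trichotomy j i with h | h | h
  · exact ⟨-(qp r 1) ^ (2 * ε j + 1), by simp only [h, if_true,
        kInv_sq_u hr, update_of_ne h.ne]⟩
  · subst h
    refine ⟨qint r ((ε j : ℂ) + 1) ^ 2, ?_⟩
    simp only [lt_irrefl, if_true, if_false, F_u (hεr j), update_self]
  · exact ⟨1, by simp [h.not_gt, h.ne']⟩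

theorem braidOp_mem_weightSpace (hr : 5 ≤ r) (i : Fin (n - 1)) {l : ℕ} (hl : l ≤ 2) :
    ∀ w ∈ weightSpace r n l, braidOp r n i w ∈ weightSpace r n l := by
  refine weightSpace_le_comap fun ε hεr hε => ?_
  have hij : (⟨i, by omega⟩ : Fin n) ≠ ⟨i + 1, by omega⟩ := by simp
  have hle := apply_add_apply_le_sum ε hij
  rw [← place_self (f := fun l => u r (ε l)) (i := ⟨i, by omega⟩) (j := ⟨i + 1, by omega⟩) rfl rfl]
  exact (braidRules_place hr _ i rfl rfl).apply_mem (by omega)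
    fun b' c' h => place_mem_weightSpace hij (by omega)

/-! ### The braid operators commute with `E` and `F` -/

theorem map_braidOp_place (hr : 5 ≤ r) (f : Fin n → V r) (i : Fin (n - 1)) {i₀ i₁ : Fin n}
    (h₀ : (i₀ : ℕ) = i) (h₁ : (i₁ : ℕ) = i + 1) {g : Fin n → Module.End ℂ (V r)} {x y : ℂ}
    (hg₀ : ∀ b, g i₀ (u r b) = (x * y ^ b) • u r b) (hg₁ : ∀ b, g i₁ (u r b) = (x * y ^ b) • u r b)
    {b c : ℕ} (hbc : b + c ≤ 2) :
    PiTensorProduct.map g (braidOp r n i (place f i₀ i₁ (u r b) (u r c))) =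
      braidOp r n i (PiTensorProduct.map g (place f i₀ i₁ (u r b) (u r c))) := by
  have hij : i₀ ≠ i₁ := fun h => by rw [h] at h₀; omega
  refine (braidRules_place hr f i h₀ h₁).diag_apply
    (braidRules_place hr (fun l => g l (f l)) i h₀ h₁) (μ := fun m => x ^ 2 * y ^ m)
    (fun b c => ?_) hbc
  rw [map_place f hij, hg₀, hg₁, place_smul_left _ hij, place_smul_right, smul_smul]
  congr 1; ring

/-- The summands of $E$ at strands other than `i₀`, `i₁` act on that pair by $k^2\otimes k^2$ or by
the identity, hence by a scalar depending on `b + c`. The two remaining summands together form the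
two-strand coproduct. -/
theorem ET_braidOp_place (hr : 5 ≤ r) (f : Fin n → V r) (i : Fin (n - 1)) {i₀ i₁ : Fin n}
    (h₀ : (i₀ : ℕ) = i) (h₁ : (i₁ : ℕ) = i + 1) {b c : ℕ} (hbc : b + c ≤ 2) :
    ET r n (braidOp r n i (place f i₀ i₁ (u r b) (u r c))) =
      braidOp r n i (ET r n (place f i₀ i₁ (u r b) (u r c))) := by
  have hij : i₀ ≠ i₁ := fun h => by rw [h] at h₀; omega
  have hlt : i₀ < i₁ := Fin.lt_def.2 (by omega)
  rw [ET, ← Finset.sum_sdiff (Finset.subset_univ {i₀, i₁})]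
  simp only [LinearMap.add_apply, map_add]
  congr 1
  · simp only [LinearMap.sum_apply, map_sum]
    refine Finset.sum_congr rfl fun l hl => ?_
    simp only [Finset.mem_sdiff, Finset.mem_univ, Finset.mem_insert, Finset.mem_singleton,
      not_or, true_and] at hl
    rcases lt_or_gt_of_ne hl.1 with h | h
    · have h' : l < i₁ := h.trans hlt
      refine map_braidOp_place hr f i h₀ h₁ (x := -(qp r 1)⁻¹) (y := (qp r 1)⁻¹ ^ 2)
        (fun b => ?_) (fun b => ?_) hbc
      · simp only [h.not_gt, h.ne', if_false, k_sq_u (show 0 < r by omega)]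
        congr 1; ring
      · simp only [h'.not_gt, h'.ne', if_false, k_sq_u (show 0 < r by omega)]
        congr 1; ring
    · have h' : i₁ < l := by
        have := Fin.val_ne_of_ne hl.2
        rw [Fin.lt_def] at h
        rw [Fin.lt_def]; omega
      refine map_braidOp_place hr f i h₀ h₁ (x := 1) (y := 1) (fun b => ?_) (fun b => ?_) hbc
      · simp [h]
      · simp [h']
  · rw [Finset.sum_pair hij]
    -- Both summands change the spectators in the same way, since no strand lies strictly between
    -- `i₀` and `i₁`.
    refine (braidRules_place hr f i h₀ h₁).lower_apply (qp_ne_zero r 1) (braidRules_place hr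
      (fun l => (if l < i₀ then 1 else k r ^ 2 : Module.End ℂ (V r)) (f l)) i h₀ h₁)
      (fun b c hbc => ?_) hbc
    rw [LinearMap.add_apply, map_place f hij, map_place f hij]
    have hE : ∀ m, m ≤ 2 → E r (u r m) = if m = 0 then 0 else u r (m - 1) := by
      intro m hm
      rcases m with _ | m
      · simp [E_u_zero]
      · simpa using E_u_succ (r := r) (m := m) (by omega)
    congr 1
    · simp only [lt_irrefl, if_false, if_true, hlt.not_gt, hlt.ne', k_sq_u (show 0 < r by omega),
        place_smul_right, hE b (by omega)]
      split_ifs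
      · rw [place_zero_left _ hij, smul_zero]
      · congr 1
        refine place_congr (fun l hl _ => ?_) _ _
        simp [hl]
    · simp only [lt_irrefl, if_false, if_true, hlt, hE c (by omega), Module.End.one_apply]
      split_ifs
      · rw [place_zero_right]
      · refine place_congr (fun l hl hl' => ?_) _ _
        have : l < i₁ ↔ l < i₀ := by
          have := Fin.val_ne_of_ne hl
          rw [Fin.lt_def, Fin.lt_def]; omega
        simp [hl', this]

theorem FT_braidOp_place (hr : 5 ≤ r) (f : Fin n → V r) (i : Fin (n - 1)) {i₀ i₁ : Fin n}
    (h₀ : (i₀ : ℕ) = i) (h₁ : (i₁ : ℕ) = i + 1) {b c : ℕ} (hbc : b + c ≤ 1) :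
    FT r n (braidOp r n i (place f i₀ i₁ (u r b) (u r c))) =
      braidOp r n i (FT r n (place f i₀ i₁ (u r b) (u r c))) := by
  have hij : i₀ ≠ i₁ := fun h => by rw [h] at h₀; omega
  have hlt : i₀ < i₁ := Fin.lt_def.2 (by omega)
  rw [FT, ← Finset.sum_sdiff (Finset.subset_univ {i₀, i₁})]
  simp only [LinearMap.add_apply, map_add]
  congr 1
  · simp only [LinearMap.sum_apply, map_sum]
    refine Finset.sum_congr rfl fun l hl => ?_
    simp only [Finset.mem_sdiff, Finset.mem_univ, Finset.mem_insert, Finset.mem_singleton,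
      not_or, true_and] at hl
    rcases lt_or_gt_of_ne hl.1 with h | h
    · have h' : l < i₁ := h.trans hlt
      refine map_braidOp_place hr f i h₀ h₁ (x := 1) (y := 1) (fun b => ?_) (fun b => ?_)
        (by omega)
      · simp [h.not_gt, h.ne']
      · simp [h'.not_gt, h'.ne']
    · have h' : i₁ < l := by
        have := Fin.val_ne_of_ne hl.2
        rw [Fin.lt_def] at h
        rw [Fin.lt_def]; omega
      refine map_braidOp_place hr f i h₀ h₁ (x := -qp r 1) (y := qp r 1 ^ 2)
        (fun b => ?_) (fun b => ?_) (by omega)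
      · simp only [show i₀ < l from h, if_true, kInv_sq_u (show 0 < r by omega)]
        congr 1; ring
      · simp only [h', if_true, kInv_sq_u (show 0 < r by omega)]
        congr 1; ring
  · rw [Finset.sum_pair hij]
    refine (braidRules_place hr f i h₀ h₁).raise_apply (φ := fun m => qint r (m + 1) ^ 2)
      (qp_ne_zero r 1) (braidRules_place hr
      (fun l => (if l < i₀ then kInv r ^ 2 else 1 : Module.End ℂ (V r)) (f l)) i h₀ h₁)
      (by simp [qint_one (show 2 ≤ r by omega)])
      (by rw [← qint_two (show 2 ≤ r by omega)]; norm_num)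
      (fun b c hbc => ?_) hbc
    rw [LinearMap.add_apply, map_place f hij, map_place f hij]
    congr 1
    · simp only [lt_irrefl, if_false, if_true, hlt.not_gt, hlt.ne', Module.End.one_apply,
        F_u (show b < r by omega), place_smul_left _ hij]
      congr 1
      refine place_congr (fun l hl _ => ?_) _ _
      simp [hl]
    · simp only [lt_irrefl, if_false, if_true, hlt, kInv_sq_u (show 0 < r by omega),
        F_u (show c < r by omega), place_smul_left _ hij, place_smul_right, smul_smul]
      congr 1
      refine place_congr (fun l hl hl' => ?_) _ _
      have : l < i₁ ↔ l < i₀ := by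
        have := Fin.val_ne_of_ne hl
        rw [Fin.lt_def, Fin.lt_def]; omega
      simp [hl', this]

theorem ET_braidOp (hr : 5 ≤ r) (i : Fin (n - 1)) {l : ℕ} (hl : l ≤ 2) :
    ∀ w ∈ weightSpace r n l, ET r n (braidOp r n i w) = braidOp r n i (ET r n w) := by
  refine eq_on_weightSpace (S := ET r n ∘ₗ braidOp r n i) (T := braidOp r n i ∘ₗ ET r n)
    fun ε hε => ?_
  have hle := apply_add_apply_le_sum ε
    (show (⟨i, by omega⟩ : Fin n) ≠ ⟨i + 1, by omega⟩ by simp)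
  rw [← place_self (f := fun l => u r (ε l)) (i := ⟨i, by omega⟩) (j := ⟨i + 1, by omega⟩) rfl rfl]
  exact ET_braidOp_place hr _ i rfl rfl (by omega)

theorem FT_braidOp (hr : 5 ≤ r) (i : Fin (n - 1)) {l : ℕ} (hl : l ≤ 1) :
    ∀ w ∈ weightSpace r n l, FT r n (braidOp r n i w) = braidOp r n i (FT r n w) := by
  refine eq_on_weightSpace (S := FT r n ∘ₗ braidOp r n i) (T := braidOp r n i ∘ₗ FT r n)
    fun ε hε => ?_
  have hle := apply_add_apply_le_sum ε
    (show (⟨i, by omega⟩ : Fin n) ≠ ⟨i + 1, by omega⟩ by simp)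
  rw [← place_self (f := fun l => u r (ε l)) (i := ⟨i, by omega⟩) (j := ⟨i + 1, by omega⟩) rfl rfl]
  exact FT_braidOp_place hr _ i rfl rfl (by omega)

/-- The operator commutes with $FE$ in weight 2. Here $F$ is only applied after $E$, in weight 1, so
it never leaves the range of `BraidRules`. -/
theorem braidOp_mem_dominantSpace (hr : 5 ≤ r) (i : Fin (n - 1)) :
    ∀ w ∈ dominantSpace r n 2, braidOp r n i w ∈ dominantSpace r n 2 := by
  rintro w ⟨hw, hw2⟩
  refine ⟨?_, braidOp_mem_weightSpace hr i le_rfl w hw2⟩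
  have hFE : ∀ v ∈ weightSpace r n 2, FT r n (ET r n (braidOp r n i v)) =
      braidOp r n i (FT r n (ET r n v)) := by
    intro v hv
    rw [ET_braidOp hr i le_rfl v hv, FT_braidOp hr i le_rfl _ (ET_mem_weightSpace (by omega) v hv)]
  have h1 : FT r n (ET r n w) ∈ weightSpace r n 2 :=
    FT_mem_weightSpace (by omega) _ (ET_mem_weightSpace (by omega) w hw2)
  have hw' : FT r n (ET r n (FT r n (ET r n w))) = 0 := hw
  change FT r n (ET r n (FT r n (ET r n (braidOp r n i w)))) = 0
  rw [hFE w hw2, hFE _ h1, hw', map_zero]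

end weight

/-! ### The braid group representation on the dominant space -/

section rep

variable {r n : ℕ}

theorem braidOp_braid (hr : 5 ≤ r) {i j : Fin (n - 1)} (hij : (i : ℕ) + 1 = j) :
    ∀ w ∈ weightSpace r n 2, braidOp r n i (braidOp r n j (braidOp r n i w)) =
      braidOp r n j (braidOp r n i (braidOp r n j w)) := by
  refine eq_on_weightSpace (S := braidOp r n i ∘ₗ braidOp r n j ∘ₗ braidOp r n i)
    (T := braidOp r n j ∘ₗ braidOp r n i ∘ₗ braidOp r n j) fun ε hε => ?_
  obtain ⟨i₀, h₀⟩ : ∃ i₀ : Fin n, (i₀ : ℕ) = i := ⟨⟨i, by omega⟩, rfl⟩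
  obtain ⟨i₁, h₁⟩ : ∃ i₁ : Fin n, (i₁ : ℕ) = i + 1 := ⟨⟨i + 1, by omega⟩, rfl⟩
  obtain ⟨i₂, h₂⟩ : ∃ i₂ : Fin n, (i₂ : ℕ) = i + 2 := ⟨⟨i + 2, by omega⟩, rfl⟩
  have n01 : i₀ ≠ i₁ := Fin.ne_of_val_ne (by omega)
  have n02 : i₀ ≠ i₂ := Fin.ne_of_val_ne (by omega)
  have n12 : i₁ ≠ i₂ := Fin.ne_of_val_ne (by omega)
  set f : Fin n → V r := fun l => u r (ε l) with hf
  let G : ℕ → ℕ → ℕ → VT r n := fun b c d => place (update f i₀ (u r b)) i₁ i₂ (u r c) (u r d)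
  -- The same tensors with the third strand moved into the background, so that the local rules for
  -- `i` apply.
  have hG : ∀ d, (fun b c => G b c d) =
      fun b c => place (update f i₂ (u r d)) i₀ i₁ (u r b) (u r c) := by
    intro d; funext b c
    simp only [G, place]
    rw [update_comm n12, update_comm n02]
  have hle : ε i₀ + ε i₁ + ε i₂ ≤ 2 := by
    have h3 : ∑ l ∈ {i₀, i₁, i₂}, ε l = ε i₀ + ε i₁ + ε i₂ := by
      rw [Finset.sum_insert (by simp [n01, n02]), Finset.sum_pair n12, add_assoc]
    rw [← hε, ← h3]
    exact Finset.sum_le_univ_sum_of_nonneg fun _ => Nat.zero_le _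
  have hx : PiTensorProduct.tprod ℂ f = G (ε i₀) (ε i₁) (ε i₂) := by
    simp only [G]
    rw [place_self] <;> simp [f, n01.symm, n02.symm]
  rw [hx]
  simp only [LinearMap.comp_apply]
  refine BraidRules.braid_apply (G := G) (qp_ne_zero r 1) (fun d => ?_) (fun b => ?_) hle
  · rw [hG]; exact braidRules_place hr _ i h₀ h₁
  · exact braidRules_place hr _ j (by omega) (by omega)

theorem braidOp_comm (hr : 5 ≤ r) {i j : Fin (n - 1)} (hij : (i : ℕ) + 1 < j) :
    ∀ w ∈ weightSpace r n 2, braidOp r n i (braidOp r n j w) =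
      braidOp r n j (braidOp r n i w) := by
  refine eq_on_weightSpace (S := braidOp r n i ∘ₗ braidOp r n j)
    (T := braidOp r n j ∘ₗ braidOp r n i) fun ε hε => ?_
  obtain ⟨i₀, h₀⟩ : ∃ i₀ : Fin n, (i₀ : ℕ) = i := ⟨⟨i, by omega⟩, rfl⟩
  obtain ⟨i₁, h₁⟩ : ∃ i₁ : Fin n, (i₁ : ℕ) = i + 1 := ⟨⟨i + 1, by omega⟩, rfl⟩
  obtain ⟨j₀, k₀⟩ : ∃ j₀ : Fin n, (j₀ : ℕ) = j := ⟨⟨j, by omega⟩, rfl⟩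
  obtain ⟨j₁, k₁⟩ : ∃ j₁ : Fin n, (j₁ : ℕ) = j + 1 := ⟨⟨j + 1, by omega⟩, rfl⟩
  have n1 : i₀ ≠ i₁ := Fin.ne_of_val_ne (by omega)
  have n2 : i₀ ≠ j₀ := Fin.ne_of_val_ne (by omega)
  have n3 : i₀ ≠ j₁ := Fin.ne_of_val_ne (by omega)
  have n4 : i₁ ≠ j₀ := Fin.ne_of_val_ne (by omega)
  have n5 : i₁ ≠ j₁ := Fin.ne_of_val_ne (by omega)
  have n6 : j₀ ≠ j₁ := Fin.ne_of_val_ne (by omega)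
  set f : Fin n → V r := fun l => u r (ε l) with hf
  let G : ℕ → ℕ → ℕ → ℕ → VT r n := fun a b c d =>
    place (update (update f i₀ (u r a)) i₁ (u r b)) j₀ j₁ (u r c) (u r d)
  have hG : ∀ c d, (fun a b => G a b c d) =
      fun a b => place (update (update f j₀ (u r c)) j₁ (u r d)) i₀ i₁ (u r a) (u r b) := by
    intro c d; funext a b
    simp only [G, place]
    rw [update_comm n4, update_comm n2, update_comm n5, update_comm n3]
  have hle := apply_add_apply_le_sum ε n1
  have hle' := apply_add_apply_le_sum ε n6
  have hx : PiTensorProduct.tprod ℂ f = G (ε i₀) (ε i₁) (ε j₀) (ε j₁) := by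
    simp only [G]
    rw [place_self] <;> simp [f, n4.symm, n5.symm]
  rw [hx]
  simp only [LinearMap.comp_apply]
  refine BraidRules.commute_apply (G := G) (q := qp r 1) (fun c d => ?_) (fun a b => ?_) (by omega)
    (by omega)
  · rw [hG]; exact braidRules_place hr _ i h₀ h₁
  · exact braidRules_place hr _ j k₀ k₁

/-! ### The cubic relation, invertibility and the representation -/

theorem sParam_eq (hr : 0 < r) : sParam r = -(qp r 1)⁻¹ := qp_self_sub_one hr

theorem cubic_eq (hr : 0 < r) : cubic r = (Polynomial.X - 1) *
    (Polynomial.X + Polynomial.C (qp r 1 ^ 2)) * (Polynomial.X - Polynomial.C (qp r 1 ^ 6)) := by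
  have h0 := qp_ne_zero r 1
  have h2 : sParam r ^ (-2 : ℤ) = qp r 1 ^ 2 := by
    rw [sParam_eq hr, ← inv_neg, inv_zpow, zpow_neg, inv_inv, zpow_ofNat]; ring
  have h4 : sParam r ^ (-4 : ℤ) * qp r 1 ^ 2 = qp r 1 ^ 6 := by
    rw [sParam_eq hr, ← inv_neg, inv_zpow, zpow_neg, inv_inv, zpow_ofNat]; ring
  rw [cubic, h2, h4]

theorem aeval_braidOp_cubic (hr : 5 ≤ r) (i : Fin (n - 1)) :
    ∀ w ∈ weightSpace r n 2, Polynomial.aeval (braidOp r n i) (cubic r) w = 0 := by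
  refine eq_on_weightSpace (T := 0) fun ε hε => ?_
  have hle := apply_add_apply_le_sum ε
    (show (⟨i, by omega⟩ : Fin n) ≠ ⟨i + 1, by omega⟩ by simp)
  rw [← place_self (f := fun l => u r (ε l)) (i := ⟨i, by omega⟩) (j := ⟨i + 1, by omega⟩) rfl rfl,
    cubic_eq (by omega)]
  simp only [map_mul, map_sub, map_add, Polynomial.aeval_X, Polynomial.aeval_C, map_one]
  exact (braidRules_place hr _ i rfl rfl).cubic_apply (qp_ne_zero r 1) (by omega)

/-- The restriction of the braid operator to the dominant space. -/
def braidEnd (hr : 5 ≤ r) (i : Fin (n - 1)) : Module.End ℂ (dominantSpace r n 2) :=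
  (braidOp r n i).restrict (braidOp_mem_dominantSpace hr i)

theorem coe_braidEnd (hr : 5 ≤ r) (i : Fin (n - 1)) (w : dominantSpace r n 2) :
    (braidEnd hr i w : VT r n) = braidOp r n i w := rfl

theorem aeval_braidEnd_cubic (hr : 5 ≤ r) (i : Fin (n - 1)) :
    Polynomial.aeval (braidEnd (n := n) hr i) (cubic r) = 0 := by
  ext1 w
  apply Subtype.ext
  -- A polynomial in the restriction is the restriction of the polynomial. The induction splits off
  -- one factor `X` acting first, so `w` must vary.
  have h : ∀ p : Polynomial ℂ, ((Polynomial.aeval (braidEnd hr i) p w : dominantSpace r n 2) :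
      VT r n) = Polynomial.aeval (braidOp r n i) p (w : VT r n) := by
    intro p
    induction p using Polynomial.induction_on generalizing w with
    | C a => simp
    | add p q hp hq => simp [hp, hq]
    | monomial m a h =>
      rw [pow_succ, ← mul_assoc]
      generalize Polynomial.C a * Polynomial.X ^ m = p at h
      rw [map_mul, map_mul, Module.End.mul_apply, Module.End.mul_apply, h]
      simp [coe_braidEnd]
  rw [h, aeval_braidOp_cubic hr i w w.2.2]
  rfl

/-- Writing $p=p_1X+p(0)$, the inverse of $a$ is $-p(0)^{-1}p_1(a)$. -/
theorem isUnit_of_aeval_eq_zero {K A : Type*} [Field K] [Ring A] [Algebra K A] {a : A}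
    {p : Polynomial K} (h : Polynomial.aeval a p = 0) (h0 : p.coeff 0 ≠ 0) : IsUnit a := by
  have hp : p.divX * Polynomial.X = p - Polynomial.C (p.coeff 0) := by
    rw [eq_sub_iff_add_eq, Polynomial.divX_mul_X_add]
  have h1 : Polynomial.aeval a p.divX * a = -algebraMap K A (p.coeff 0) := by
    have := congrArg (Polynomial.aeval a) hp
    rwa [map_mul, map_sub, h, zero_sub, Polynomial.aeval_X, Polynomial.aeval_C] at this
  have h2 : a * Polynomial.aeval a p.divX = Polynomial.aeval a p.divX * a := by
    have := congrArg (Polynomial.aeval a) (mul_comm Polynomial.X p.divX)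
    rwa [map_mul, map_mul, Polynomial.aeval_X] at this
  have h3 : algebraMap K A (-(p.coeff 0)⁻¹) * -algebraMap K A (p.coeff 0) = 1 := by
    rw [← map_neg, ← map_mul, neg_mul_neg, inv_mul_cancel₀ h0, map_one]
  refine ⟨⟨a, algebraMap K A (-(p.coeff 0)⁻¹) * Polynomial.aeval a p.divX, ?_, ?_⟩, rfl⟩
  · rw [← mul_assoc, ← Algebra.commutes, mul_assoc, h2, h1, h3]
  · rw [mul_assoc, h1, h3]

theorem cubic_coeff_zero_ne_zero (hr : 0 < r) : (cubic r).coeff 0 ≠ 0 := by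
  have := qp_ne_zero r 1
  rw [Polynomial.coeff_zero_eq_eval_zero, cubic_eq hr]
  simp [this]

theorem isUnit_of_aeval_cubic {M : Type*} [AddCommGroup M] [Module ℂ M] {A : Module.End ℂ M}
    (hr : 0 < r) (h : Polynomial.aeval A (cubic r) = 0) : IsUnit A :=
  isUnit_of_aeval_eq_zero h (cubic_coeff_zero_ne_zero hr)

theorem isUnit_braidEnd (hr : 5 ≤ r) (i : Fin (n - 1)) : IsUnit (braidEnd (n := n) hr i) :=
  isUnit_of_aeval_cubic (by omega) (aeval_braidEnd_cubic hr i)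

theorem lift_braidRels_eq_one {G : Type*} [Group G] {f : Fin (n - 1) → G}
    (hcomm : ∀ i j : Fin (n - 1), (i : ℕ) + 1 < j → f i * f j = f j * f i)
    (hbraid : ∀ i j : Fin (n - 1), (i : ℕ) + 1 = j → f i * f j * f i = f j * f i * f j) :
    ∀ w ∈ braidRels n, FreeGroup.lift f w = 1 := by
  rintro w (⟨i, j, hij, rfl⟩ | ⟨i, j, hij, rfl⟩)
  · simp only [map_mul, map_inv, FreeGroup.lift_apply_of, mul_inv_eq_one]
    exact hcomm i j hij
  · simp only [map_mul, map_inv, FreeGroup.lift_apply_of, mul_inv_eq_one]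
    exact hbraid i j hij

theorem exists_isDominantRep (hr : 5 ≤ r) :
    ∃ ρ : Representation ℂ (BraidGroup n) (dominantSpace r n 2),
      IsDominantRep ρ ∧ ∀ i, ρ (sigma i) = braidEnd hr i := by
  choose f hf using isUnit_braidEnd (n := n) hr
  have hrel : ∀ w ∈ braidRels n, FreeGroup.lift f w = 1 := by
    refine lift_braidRels_eq_one (fun i j hij => Units.ext ?_) (fun i j hij => Units.ext ?_)
    · rw [Units.val_mul, Units.val_mul, hf, hf]
      ext1 w
      exact Subtype.ext (braidOp_comm hr hij w w.2.2)
    · simp only [Units.val_mul, hf]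
      ext1 w
      exact Subtype.ext (braidOp_braid hr hij w w.2.2)
  have hσ : ∀ i, (Units.coeHom _).comp (PresentedGroup.toGroup hrel) (sigma i) =
      braidEnd hr i := by
    intro i
    rw [MonoidHom.comp_apply, sigma, PresentedGroup.toGroup.of, Units.coeHom_apply, hf]
  refine ⟨(Units.coeHom _).comp (PresentedGroup.toGroup hrel), fun i w => ?_, hσ⟩
  rw [hσ, coe_braidEnd]

end rep

/-! ### Endomorphisms annihilated by a cubic with distinct roots -/

section cubic

open Polynomial

theorem isCoprime_X_sub_C {K : Type*} [Field K] {a b : K} (h : a ≠ b) :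
    IsCoprime (X - C a) (X - C b) :=
  Polynomial.pairwise_coprime_X_sub_C (s := id) injective_id h

theorem cubic_dvd_of_isRoot {K : Type*} [Field K] {a b c : K} (hab : a ≠ b) (hac : a ≠ c)
    (hbc : b ≠ c) {p : K[X]} (ha : p.IsRoot a) (hb : p.IsRoot b) (hc : p.IsRoot c) :
    (X - C a) * (X - C b) * (X - C c) ∣ p :=
  ((isCoprime_X_sub_C hac).mul_left (isCoprime_X_sub_C hbc)).mul_dvd
    ((isCoprime_X_sub_C hab).mul_dvd (dvd_iff_isRoot.2 ha) (dvd_iff_isRoot.2 hb))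
    (dvd_iff_isRoot.2 hc)

variable {M : Type*} [AddCommGroup M] [Module ℂ M] {A : Module.End ℂ M} {a b c : ℂ}

theorem pow_eq_one_of_aeval_cubic (hab : a ≠ b) (hac : a ≠ c) (hbc : b ≠ c)
    (h : aeval A ((X - C a) * (X - C b) * (X - C c)) = 0) {m : ℕ} (ha : a ^ m = 1)
    (hb : b ^ m = 1) (hc : c ^ m = 1) : A ^ m = 1 := by
  have hd : (X - C a) * (X - C b) * (X - C c) ∣ (X ^ m - 1 : ℂ[X]) :=
    cubic_dvd_of_isRoot hab hac hbc (by simp [ha]) (by simp [hb]) (by simp [hc])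
  obtain ⟨p, hp⟩ := hd
  have := congrArg (aeval A) hp
  rw [map_mul, h, zero_mul, map_sub, map_pow, aeval_X, map_one] at this
  exact sub_eq_zero.1 this

theorem aeval_X_sub_C_eq_zero_iff (w : M) : aeval A (X - C a) w = 0 ↔ A w = a • w := by
  rw [map_sub, aeval_X, aeval_C, LinearMap.sub_apply, Module.algebraMap_end_apply, sub_eq_zero]

theorem aeval_apply_of_apply_eq_smul {w : M} (hw : A w = a • w) (p : ℂ[X]) :
    aeval A p w = p.eval a • w := by
  by_cases h0 : w = 0
  · simp [h0]
  · exact Module.End.aeval_apply_of_hasEigenvector ⟨Module.End.mem_eigenspace_iff.2 hw, h0⟩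

theorem isRoot_minpoly_of_apply_eq_smul {w : M} (h0 : w ≠ 0) (hw : A w = a • w) :
    (minpoly ℂ A).IsRoot a := by
  have := aeval_apply_of_apply_eq_smul hw (minpoly ℂ A)
  rw [minpoly.aeval, LinearMap.zero_apply] at this
  exact (smul_eq_zero.1 this.symm).resolve_right h0

theorem minpoly_eq_cubic (hab : a ≠ b) (hac : a ≠ c) (hbc : b ≠ c)
    (h : aeval A ((X - C a) * (X - C b) * (X - C c)) = 0)
    (ha : ∃ w ≠ 0, A w = a • w) (hb : ∃ w ≠ 0, A w = b • w) (hc : ∃ w ≠ 0, A w = c • w) :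
    minpoly ℂ A = (X - C a) * (X - C b) * (X - C c) := by
  have hm : ((X - C a) * (X - C b) * (X - C c)).Monic :=
    ((monic_X_sub_C a).mul (monic_X_sub_C b)).mul (monic_X_sub_C c)
  obtain ⟨x, hx, hx'⟩ := ha
  obtain ⟨y, hy, hy'⟩ := hb
  obtain ⟨z, hz, hz'⟩ := hc
  refine eq_of_monic_of_associated (minpoly.monic ⟨_, hm, h⟩) hm (associated_of_dvd_dvd
    (minpoly.dvd ℂ A h) (cubic_dvd_of_isRoot hab hac hbc ?_ ?_ ?_))
  exacts [isRoot_minpoly_of_apply_eq_smul hx hx', isRoot_minpoly_of_apply_eq_smul hy hy',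
    isRoot_minpoly_of_apply_eq_smul hz hz']

theorem ker_aeval_X_sub_C (A : Module.End ℂ M) (a : ℂ) :
    LinearMap.ker (aeval A (X - C a)) = A.eigenspace a := by
  ext w
  rw [LinearMap.mem_ker, aeval_X_sub_C_eq_zero_iff, Module.End.mem_eigenspace_iff]

/-- Kernels of coprime factors add up to the kernel of the product, which is the whole space. -/
theorem iSup_eigenspace_eq_top_of_aeval_cubic (hab : a ≠ b) (hac : a ≠ c) (hbc : b ≠ c)
    (h : aeval A ((X - C a) * (X - C b) * (X - C c)) = 0) : ⨆ μ, A.eigenspace μ = ⊤ := by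
  have h1 := sup_ker_aeval_eq_ker_aeval_mul_of_coprime A
    ((isCoprime_X_sub_C hac).mul_left (isCoprime_X_sub_C hbc))
  rw [← sup_ker_aeval_eq_ker_aeval_mul_of_coprime A (isCoprime_X_sub_C hab), h, LinearMap.ker_zero,
    ker_aeval_X_sub_C, ker_aeval_X_sub_C, ker_aeval_X_sub_C] at h1
  rw [eq_top_iff, ← h1]
  exact sup_le (sup_le (le_iSup A.eigenspace a) (le_iSup A.eigenspace b)) (le_iSup A.eigenspace c)

theorem isDiagonalizable_of_iSup_eigenspace {M : Type} [AddCommGroup M] [Module ℂ M]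
    {A : Module.End ℂ M} (h : ⨆ μ, A.eigenspace μ = ⊤) : IsDiagonalizable A := by
  classical
  have hi : DirectSum.IsInternal A.eigenspace :=
    DirectSum.isInternal_submodule_of_iSupIndep_of_iSup_eq_top A.eigenspaces_iSupIndep h
  refine ⟨_, hi.collectedBasis fun μ => Module.Basis.ofVectorSpace ℂ (A.eigenspace μ),
    fun j => j.1, fun j => ?_⟩
  exact Module.End.mem_eigenspace_iff.1 (hi.collectedBasis_mem _ j)

end cubic

/-! ### Eigenvectors in the kernel of `E` -/

section eigenvectors

variable {r n : ℕ}

/-- The elementary tensor with factors `u_b`, `u_c`, `u_d` at `i₀`, `i₁`, `i₂`, and `x` at all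
other places. -/
def triple (x : V r) (i₀ i₁ i₂ : Fin n) (b c d : ℕ) : VT r n :=
  place (update (fun _ => x) i₀ (u r b)) i₁ i₂ (u r c) (u r d)

theorem place_update_smul (f : Fin n → V r) {i₀ i₁ i₂ : Fin n} (h1 : i₀ ≠ i₁) (h2 : i₀ ≠ i₂)
    (a : ℂ) (x y z : V r) :
    place (update f i₀ (a • x)) i₁ i₂ y z = a • place (update f i₀ x) i₁ i₂ y z := by
  simp only [place]
  rw [update_comm h1, update_comm h2, MultilinearMap.map_update_smul, update_comm h2.symm,
    update_comm h1.symm]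

theorem place_update_zero (f : Fin n → V r) {i₀ i₁ i₂ : Fin n} (h1 : i₀ ≠ i₁) (h2 : i₀ ≠ i₂)
    (y z : V r) : place (update f i₀ 0) i₁ i₂ y z = 0 := by
  simpa using place_update_smul f h1 h2 0 0 y z

theorem map_triple {x y : V r} {i₀ i₁ i₂ : Fin n} (h01 : i₀ ≠ i₁) (h02 : i₀ ≠ i₂) (h12 : i₁ ≠ i₂)
    {g : Fin n → Module.End ℂ (V r)} (hg : ∀ l, l ≠ i₀ → l ≠ i₁ → l ≠ i₂ → g l x = y)
    (b c d : ℕ) : PiTensorProduct.map g (triple x i₀ i₁ i₂ b c d) =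
      place (update (fun _ => y) i₀ (g i₀ (u r b))) i₁ i₂ (g i₁ (u r c)) (g i₂ (u r d)) := by
  rw [triple, map_place _ h12]
  refine place_congr (fun l h1 h2 => ?_) _ _
  by_cases h0 : l = i₀
  · subst h0; simp
  · simp [h0, hg l h0 h1 h2]

/-- On the first three strands this is the threefold coproduct. The other strands all become
$k^2u_0$, which is left unevaluated because it is common to all terms. -/
theorem ET_triple (hr : 5 ≤ r) {i₀ i₁ i₂ : Fin n} (h₀ : (i₀ : ℕ) = 0) (h₁ : (i₁ : ℕ) = 1)
    (h₂ : (i₂ : ℕ) = 2) {b c d : ℕ} (h : b + c + d ≤ 2) :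
    ET r n (triple (u r 0) i₀ i₁ i₂ b c d) =
      (if b = 0 then 0 else ((qp r 1)⁻¹ ^ (2 * c + 2 * d + 2)) •
        triple ((k r ^ 2) (u r 0)) i₀ i₁ i₂ (b - 1) c d) +
      (if c = 0 then 0 else (-(qp r 1)⁻¹ ^ (2 * d + 1)) •
        triple ((k r ^ 2) (u r 0)) i₀ i₁ i₂ b (c - 1) d) +
      (if d = 0 then 0 else triple ((k r ^ 2) (u r 0)) i₀ i₁ i₂ b c (d - 1)) := by
  have h01 : i₀ ≠ i₁ := Fin.ne_of_val_ne (by omega)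
  have h02 : i₀ ≠ i₂ := Fin.ne_of_val_ne (by omega)
  have h12 : i₁ ≠ i₂ := Fin.ne_of_val_ne (by omega)
  have l01 : i₀ < i₁ := Fin.lt_def.2 (by omega)
  have l02 : i₀ < i₂ := Fin.lt_def.2 (by omega)
  have l12 : i₁ < i₂ := Fin.lt_def.2 (by omega)
  have hE : ∀ m, m ≤ 2 → E r (u r m) = if m = 0 then 0 else u r (m - 1) := by
    intro m hm
    rcases m with _ | m
    · simp [E_u_zero]
    · simpa using E_u_succ (r := r) (m := m) (by omega)
  have hbig : ∀ l : Fin n, l ≠ i₀ → l ≠ i₁ → l ≠ i₂ → i₂ < l := by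
    intro l k0 k1 k2
    have := Fin.val_ne_of_ne k0
    have := Fin.val_ne_of_ne k1
    have := Fin.val_ne_of_ne k2
    rw [Fin.lt_def]; omega
  have hk : ∀ i l : Fin n, i ≤ i₂ → l ≠ i₀ → l ≠ i₁ → l ≠ i₂ →
      (if l < i then (1 : Module.End ℂ (V r)) else if l = i then E r else k r ^ 2) (u r 0) =
        (k r ^ 2) (u r 0) := by
    intro i l hi k0 k1 k2
    have h2 : i < l := hi.trans_lt (hbig l k0 k1 k2)
    rw [if_neg h2.not_gt, if_neg h2.ne']
  -- A summand with $E$ beyond the third strand vanishes, as $Eu_0=0$.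
  rw [ET, LinearMap.sum_apply, ← Finset.sum_subset (Finset.subset_univ {i₀, i₁, i₂}),
    Finset.sum_insert (by simp [h01, h02]), Finset.sum_pair h12, add_assoc]
  · rw [map_triple h01 h02 h12 (hk i₀ · l02.le), map_triple h01 h02 h12 (hk i₁ · l12.le),
      map_triple h01 h02 h12 (hk i₂ · le_rfl)]
    refine congrArg₂ (· + ·) ?_ (congrArg₂ (· + ·) ?_ ?_)
    · simp only [lt_irrefl, if_false, if_true, l01.not_gt, l02.not_gt, h01.symm, h02.symm,
        k_sq_u (show 0 < r by omega), hE b (by omega), place_smul_right, place_smul_left _ h12,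
        smul_smul]
      split_ifs
      · rw [place_update_zero _ h01 h02, smul_zero]
      · rw [triple]; congr 1; ring
    · simp only [lt_irrefl, if_false, if_true, l01, l12.not_gt, h12.symm,
        k_sq_u (show 0 < r by omega), hE c (by omega), place_smul_right, Module.End.one_apply]
      split_ifs
      · rw [place_zero_left _ h12, smul_zero]
      · rw [triple]
    · simp only [lt_irrefl, if_false, if_true, l02, l12, hE d (by omega), Module.End.one_apply]
      split_ifs
      · rw [place_zero_right]
      · rw [triple]
  · intro l _ hl
    simp only [Finset.mem_insert, Finset.mem_singleton, not_or] at hl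
    rw [triple, place, PiTensorProduct.map_tprod]
    exact MultilinearMap.map_coord_zero _ l (by simp [hl, E_u_zero])

theorem triple_mem_weightSpace {i₀ i₁ i₂ : Fin n} (h01 : i₀ ≠ i₁) (h02 : i₀ ≠ i₂) (h12 : i₁ ≠ i₂)
    {b c d l : ℕ} (h : b + c + d = l) :
    triple (u r 0) i₀ i₁ i₂ b c d ∈ weightSpace r n l := by
  have hs := sum_update_add_apply (0 : Fin n → ℕ) i₀ b
  have hf : update (fun _ : Fin n => u r 0) i₀ (u r b) =
      fun l => u r (update (0 : Fin n → ℕ) i₀ b l) := by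
    funext l
    by_cases hl : l = i₀
    · subst hl; simp
    · simp [hl]
  rw [triple, hf]
  simp only [Pi.zero_apply, Finset.sum_const_zero] at hs
  refine place_mem_weightSpace h12 ?_
  rw [update_of_ne h01.symm, update_of_ne h02.symm, Pi.zero_apply, Pi.zero_apply]
  omega

/-- A coordinate functional separating `u_2 ⊗ u_0 ⊗ u_0 ⊗ ⋯` from the other basis vectors of the
same weight. -/
theorem exists_functional (hr : 5 ≤ r) {i₀ i₁ i₂ : Fin n} (h01 : i₀ ≠ i₁) (h02 : i₀ ≠ i₂) :
    ∃ φ : VT r n →ₗ[ℂ] ℂ, φ (triple (u r 0) i₀ i₁ i₂ 2 0 0) = 1 ∧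
      ∀ b c d, b < 2 → φ (triple (u r 0) i₀ i₁ i₂ b c d) = 0 := by
  let p : Fin n → Fin r := update (fun _ => ⟨0, by omega⟩) i₀ ⟨2, by omega⟩
  let B := Basis.piTensorProduct fun _ : Fin n => uBasis r
  refine ⟨B.coord p, ?_, fun b c d hb => ?_⟩
  · rw [Module.Basis.coord_apply, triple, place, Basis.piTensorProduct_repr_tprod_apply]
    refine Finset.prod_eq_one fun l _ => ?_
    by_cases h2 : l = i₂
    · subst h2
      simp [p, h02.symm, u_of_lt (show 0 < r by omega)]
    · by_cases h1 : l = i₁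
      · subst h1
        simp [p, h2, h01.symm, u_of_lt (show 0 < r by omega)]
      · by_cases h0 : l = i₀
        · subst h0
          simp [p, h1, h2, u_of_lt (show 2 < r by omega)]
        · simp [p, h0, h1, h2, u_of_lt (show 0 < r by omega)]
  · rw [Module.Basis.coord_apply, triple, place, Basis.piTensorProduct_repr_tprod_apply]
    refine Finset.prod_eq_zero (Finset.mem_univ i₀) ?_
    simp only [p, update_of_ne h01, update_of_ne h02, update_self, u_of_lt (show b < r by omega),
      Module.Basis.repr_self]
    rw [Finsupp.single_eq_of_ne]
    intro h
    have := congrArg Fin.val h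
    simp at this
    omega

theorem exists_eigenvector_of_zero (hr : 5 ≤ r) (hn : 3 ≤ n) {i : Fin (n - 1)} (hi : (i : ℕ) = 0)
    {μ : ℂ} (hμ : μ = 1 ∨ μ = -qp r 1 ^ 2 ∨ μ = qp r 1 ^ 6) :
    ∃ w : dominantSpace r n 2, w ≠ 0 ∧ braidEnd hr i w = μ • w := by
  obtain ⟨i₀, h₀⟩ : ∃ i₀ : Fin n, (i₀ : ℕ) = 0 := ⟨⟨0, by omega⟩, rfl⟩
  obtain ⟨i₁, h₁⟩ : ∃ i₁ : Fin n, (i₁ : ℕ) = 1 := ⟨⟨1, by omega⟩, rfl⟩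
  obtain ⟨i₂, h₂⟩ : ∃ i₂ : Fin n, (i₂ : ℕ) = 2 := ⟨⟨2, by omega⟩, rfl⟩
  have h01 : i₀ ≠ i₁ := Fin.ne_of_val_ne (by omega)
  have h02 : i₀ ≠ i₂ := Fin.ne_of_val_ne (by omega)
  have h12 : i₁ ≠ i₂ := Fin.ne_of_val_ne (by omega)
  have hq := qp_ne_zero r 1
  have hz1 : qp r 1 ^ 2 + 1 ≠ 0 := fun h =>
    qp_one_pow_ne_neg_one (r := r) (m := 2) (by omega) (eq_neg_of_add_eq_zero_left h)
  have hE := fun b c d (h : b + c + d ≤ 2) => ET_triple hr h₀ h₁ h₂ h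
  obtain ⟨φ, hφ, hφ0⟩ := exists_functional (r := r) hr (i₂ := i₂) h01 h02
  have hS : ∀ d, BraidRules (qp r 1) (braidOp r n i)
      (fun b c => triple (u r 0) i₀ i₁ i₂ b c d) := by
    intro d
    have : (fun b c => triple (u r 0) i₀ i₁ i₂ b c d) =
        fun b c => place (update (fun _ => u r 0) i₂ (u r d)) i₀ i₁ (u r b) (u r c) := by
      funext b c
      simp only [triple, place]
      rw [update_comm h12, update_comm h02]
    rw [this]
    exact braidRules_place hr _ i (by omega) (by omega)
  have s00 := fun d => (hS d).h00
  have s01 := fun d => (hS d).h01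
  have s10 := fun d => (hS d).h10
  have s02 := fun d => (hS d).h02
  have s11 := fun d => (hS d).h11
  have s20 := fun d => (hS d).h20
  have hW := fun b c d (h : b + c + d = 2) => triple_mem_weightSpace (r := r) h01 h02 h12 h
  have e020 := hE 0 2 0 (by omega)
  have e110 := hE 1 1 0 (by omega)
  have e200 := hE 2 0 0 (by omega)
  have e011 := hE 0 1 1 (by omega)
  have e101 := hE 1 0 1 (by omega)
  have e002 := hE 0 0 2 (by omega)
  have f020 := hφ0 0 2 0 (by omega)
  have f110 := hφ0 1 1 0 (by omega)
  have f011 := hφ0 0 1 1 (by omega)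
  have f101 := hφ0 1 0 1 (by omega)
  have f002 := hφ0 0 0 2 (by omega)
  norm_num at e020 e110 e200 e011 e101 e002
  have w020 := hW 0 2 0 rfl
  have w110 := hW 1 1 0 rfl
  have w200 := hW 2 0 0 rfl
  have w011 := hW 0 1 1 rfl
  have w101 := hW 1 0 1 rfl
  have w002 := hW 0 0 2 rfl
  -- Vectors killed by $E$ lie in $\ker (FE)^2$; the coordinate `φ` witnesses that they are nonzero.
  suffices H : ∃ w ∈ weightSpace r n 2, ET r n w = 0 ∧ φ w ≠ 0 ∧ braidOp r n i w = μ • w by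
    obtain ⟨w, hw, hE, hw0, hS⟩ := H
    refine ⟨⟨w, ?_, hw⟩, fun h => hw0 ?_, Subtype.ext hS⟩
    · rw [SetLike.mem_coe, LinearMap.mem_ker, pow_two, Module.End.mul_apply, Module.End.mul_apply,
        Module.End.mul_apply, hE, map_zero, map_zero, map_zero]
    · have : w = 0 := congrArg Subtype.val h
      rw [this, map_zero]
  clear hE hφ0 hW
  generalize qp r 1 = q at *
  generalize triple (u r 0) i₀ i₁ i₂ = G at *
  rcases hμ with rfl | rfl | rfl
  -- Each power of the third factor contributes one 1-eigenvector of the first two strands. $E$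
  -- sends their three-dimensional span to the two-dimensional 1-eigenspace of weight 1, and the
  -- witness spans the kernel.
  · refine ⟨(q ^ 2 * (1 + q ^ 2)) • G 0 2 0 + (-q ^ 3) • G 1 1 0 + (1 + q ^ 2) • G 2 0 0 +
      (-q⁻¹ * (q⁻¹ + q + q ^ 3)) • ((-q) • G 0 1 1 + G 1 0 1) +
      (q⁻¹ ^ 4 * (q⁻¹ + q + q ^ 3) * (q + q⁻¹)) • G 0 0 2, ?_, ?_, ?_, ?_⟩
    · apply_rules [Submodule.add_mem, Submodule.smul_mem]
    · simp only [map_add, map_smul, e020, e110, e200, e011, e101, e002]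
      match_scalars <;> field_simp <;> ring
    · simpa [hφ, f020, f110, f011, f101, f002, add_comm] using hz1
    · simp only [map_add, map_smul, s00, s01, s10, s02, s11, s20]
      match_scalars <;> field_simp <;> ring
  -- The same count for $-q^2$: two eigenvectors, of local weights 2 and 1, are mapped by $E$ to a
  -- single line.
  · refine ⟨(q ^ 2 + 1) • G 0 2 0 + (q * (q ^ 2 - 1)) • G 1 1 0 + (-(q ^ 2 + 1)) • G 2 0 0 +
      (q + q⁻¹ ^ 3) • (G 0 1 1 + q • G 1 0 1), ?_, ?_, ?_, ?_⟩
    · apply_rules [Submodule.add_mem, Submodule.smul_mem]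
    · simp only [map_add, map_smul, e020, e110, e200, e011, e101]
      match_scalars <;> field_simp <;> ring
    · simp only [map_add, map_smul, hφ, f020, f110, f011, f101]
      simpa [-neg_add_rev] using hz1
    · simp only [map_add, map_smul, s01, s10, s02, s11, s20]
      match_scalars <;> field_simp <;> ring
  -- The eigenvalue $q^6$ occurs only in local weight 2, so its eigenvector is killed by $E$ without
  -- a correction on the third strand.
  · refine ⟨G 0 2 0 + q ^ 3 • G 1 1 0 + q ^ 4 • G 2 0 0, ?_, ?_, ?_, ?_⟩
    · apply_rules [Submodule.add_mem, Submodule.smul_mem]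
    · simp only [map_add, map_smul, e020, e110, e200]
      match_scalars <;> field_simp <;> ring
    · simp [hφ, f020, f110, hq]
    · simp only [map_add, map_smul, s02, s11, s20]
      match_scalars <;> field_simp <;> ring

/-- Invertible endomorphisms satisfying the braid relation have the same eigenvalues. -/
theorem exists_eigenvector_of_braid {M : Type*} [AddCommGroup M] [Module ℂ M]
    {A B : Module.End ℂ M} (hA : IsUnit A) (hB : IsUnit B)
    (hAB : ∀ w, A (B (A w)) = B (A (B w))) {μ : ℂ} (h : ∃ w : M, w ≠ 0 ∧ A w = μ • w) :
    ∃ w : M, w ≠ 0 ∧ B w = μ • w := by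
  obtain ⟨w, hw0, hw⟩ := h
  have hA' := (map_ne_zero_iff A ((Module.End.isUnit_iff A).1 hA).injective (x := B w)).2
  have hB' := (map_ne_zero_iff B ((Module.End.isUnit_iff B).1 hB).injective (x := w)).2
  exact ⟨A (B w), hA' (hB' hw0), by rw [← hAB, hw, map_smul, map_smul]⟩

theorem exists_eigenvector (hr : 5 ≤ r) (hn : 3 ≤ n) {μ : ℂ}
    (hμ : μ = 1 ∨ μ = -qp r 1 ^ 2 ∨ μ = qp r 1 ^ 6) (i : Fin (n - 1)) :
    ∃ w : dominantSpace r n 2, w ≠ 0 ∧ braidEnd hr i w = μ • w := by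
  obtain ⟨m, hm⟩ := i
  induction m with
  | zero => exact exists_eigenvector_of_zero hr hn rfl hμ
  | succ m ih =>
    have hm' : m < n - 1 := by omega
    have hij : ((⟨m, hm'⟩ : Fin (n - 1)) : ℕ) + 1 = (⟨m + 1, hm⟩ : Fin (n - 1)) := rfl
    have hb : ∀ w, braidEnd hr ⟨m, hm'⟩ (braidEnd hr ⟨m + 1, hm⟩ (braidEnd hr ⟨m, hm'⟩ w)) =
        braidEnd hr ⟨m + 1, hm⟩ (braidEnd hr ⟨m, hm'⟩ (braidEnd hr ⟨m + 1, hm⟩ w)) :=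
      fun w => Subtype.ext (braidOp_braid hr hij w w.2.2)
    exact exists_eigenvector_of_braid (isUnit_braidEnd hr _) (isUnit_braidEnd hr _) hb (ih hm')

end eigenvectors

/-- The exponent sum shows that the standard generators have infinite order. -/
theorem sigma_pow_ne_one {n : ℕ} (i : Fin (n - 1)) {m : ℕ} (hm : m ≠ 0) :
    (sigma i : BraidGroup n) ^ m ≠ 1 := by
  intro h
  have hrel : ∀ w ∈ braidRels n,
      FreeGroup.lift (fun _ => Multiplicative.ofAdd (1 : ℤ)) w = 1 :=
    lift_braidRels_eq_one (fun _ _ _ => rfl) (fun _ _ _ => rfl)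
  have h1 : PresentedGroup.toGroup hrel (sigma i) ^ m = 1 := by rw [← map_pow, h, map_one]
  have h2 : PresentedGroup.toGroup hrel (sigma i) = Multiplicative.ofAdd 1 :=
    PresentedGroup.toGroup.of hrel
  rw [h2, ← ofAdd_nsmul, ofAdd_eq_one] at h1
  simp [hm] at h1

/-! ### The three roots and the resulting properties of the generators -/

theorem cubic_eq_prod_X_sub_C {r : ℕ} (hr : 0 < r) : cubic r =
    (Polynomial.X - Polynomial.C 1) * (Polynomial.X - Polynomial.C (-qp r 1 ^ 2)) *
      (Polynomial.X - Polynomial.C (qp r 1 ^ 6)) := by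
  rw [cubic_eq hr, Polynomial.C_neg, sub_neg_eq_add, Polynomial.C_1]

/-- The conditions are $q^2\ne-1$, $q^6\ne1$ and $q^4\ne-1$. The last fails for $r=4$, where $-q^2$
and $q^6$ coincide. -/
theorem roots_pairwise_ne {r : ℕ} (hr : 5 ≤ r) :
    (1 : ℂ) ≠ -qp r 1 ^ 2 ∧ (1 : ℂ) ≠ qp r 1 ^ 6 ∧ -qp r 1 ^ 2 ≠ qp r 1 ^ 6 := by
  refine ⟨fun h => ?_, (qp_one_pow_ne_one (by omega) (by omega)).symm, fun h => ?_⟩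
  · exact qp_one_pow_ne_neg_one (r := r) (m := 2) (by omega) (neg_eq_iff_eq_neg.1 h.symm)
  · refine qp_one_pow_ne_neg_one (r := r) (m := 4) (by omega)
      (mul_left_cancel₀ (pow_ne_zero 2 (qp_ne_zero r 1)) ?_)
    rw [← pow_add, ← h, mul_neg_one]

section conclusion

variable {r : ℕ} {M : Type} [AddCommGroup M] [Module ℂ M] {A : Module.End ℂ M}

/-- Divisibility by $r$ makes $(q^2)^m=1$; evenness is needed for the sign in $-q^2$. This is the
source of the exponents $r$ and $2r$ according to the parity of $r$. -/
theorem pow_eq_one_of_even (hr : 5 ≤ r) (h : Polynomial.aeval A (cubic r) = 0) {m : ℕ}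
    (hm : Even m) (hrm : r ∣ m) : A ^ m = 1 := by
  obtain ⟨h1, h2, h3⟩ := roots_pairwise_ne hr
  rw [cubic_eq_prod_X_sub_C (by omega)] at h
  have hq : (qp r 1 ^ 2) ^ m = 1 := by
    obtain ⟨t, rfl⟩ := hrm
    rw [← pow_mul, mul_left_comm, pow_mul, qp_one_pow_self (by omega), pow_mul, neg_one_sq, one_pow]
  refine pow_eq_one_of_aeval_cubic h1 h2 h3 h (one_pow m) ?_ ?_
  · rw [hm.neg_pow, hq]
  · rw [show 6 = 2 * 3 from rfl, pow_mul, ← pow_mul, mul_comm, pow_mul, hq, one_pow]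

theorem isDiagonalizable_of_aeval_cubic (hr : 5 ≤ r) (h : Polynomial.aeval A (cubic r) = 0) :
    IsDiagonalizable A := by
  obtain ⟨h1, h2, h3⟩ := roots_pairwise_ne hr
  rw [cubic_eq_prod_X_sub_C (by omega)] at h
  exact isDiagonalizable_of_iSup_eigenspace (iSup_eigenspace_eq_top_of_aeval_cubic h1 h2 h3 h)

theorem minpoly_eq_cubic_of_eigenvectors (hr : 5 ≤ r) (h : Polynomial.aeval A (cubic r) = 0)
    (hev : ∀ μ, μ = 1 ∨ μ = -qp r 1 ^ 2 ∨ μ = qp r 1 ^ 6 → ∃ w : M, w ≠ 0 ∧ A w = μ • w) :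
    minpoly ℂ A = cubic r := by
  obtain ⟨h1, h2, h3⟩ := roots_pairwise_ne hr
  rw [cubic_eq_prod_X_sub_C (by omega)] at h ⊢
  exact minpoly_eq_cubic h1 h2 h3 h (hev _ (.inl rfl)) (hev _ (.inr (.inl rfl)))
    (hev _ (.inr (.inr rfl)))

end conclusion

end BraidExt

end

/-- For `n ≥ 3`, `r ≥ 5` and `ℓ' ∈ {0, 1}` with `ℓ' ≡ 1 - n - 2 (mod r)`, the representation
`N_{n,2,ℓ'}` is the one on `dominantSpace r n 2`. -/
theorem mainTheorem10 (n r l' : ℕ) (hn : 3 ≤ n) (hr : 5 ≤ r) (hl' : l' < 2)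
    (hmod : (l' : ℤ) ≡ 1 - (n : ℤ) - 2 [ZMOD (r : ℤ)]) :
    ∃ ρ : Representation ℂ (BraidExt.BraidGroup n) (BraidExt.dominantSpace r n 2),
      BraidExt.IsDominantRep ρ ∧
      ¬ Function.Injective ρ ∧
      ∀ i : Fin (n - 1),
        minpoly ℂ (ρ (BraidExt.sigma i)) = BraidExt.cubic r ∧
        BraidExt.IsDiagonalizable (ρ (BraidExt.sigma i)) ∧
        (Even r → Subgroup.zpowers (BraidExt.sigma i ^ r) ≤ MonoidHom.ker ρ) ∧
        (Odd r → Subgroup.zpowers (BraidExt.sigma i ^ (2 * r)) ≤ MonoidHom.ker ρ) := by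
  obtain ⟨ρ, hρ, hσ⟩ := BraidExt.exists_isDominantRep (n := n) hr
  have hcub : ∀ i, Polynomial.aeval (ρ (BraidExt.sigma i)) (BraidExt.cubic r) = 0 := by
    intro i
    rw [hσ]
    exact BraidExt.aeval_braidEnd_cubic hr i
  have hpow : ∀ (i : Fin (n - 1)) (m : ℕ), Even m → r ∣ m → ρ (BraidExt.sigma i ^ m) = 1 := by
    intro i m hm hrm
    rw [map_pow]
    exact BraidExt.pow_eq_one_of_even hr (hcub i) hm hrm
  refine ⟨ρ, hρ, fun hinj => ?_, fun i => ⟨?_, ?_, fun hev => ?_, fun _ => ?_⟩⟩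
  · refine BraidExt.sigma_pow_ne_one (⟨0, by omega⟩ : Fin (n - 1)) (m := 2 * r) (by omega)
      (hinj ?_)
    rw [hpow _ _ (even_two_mul r) (Dvd.intro_left 2 rfl), map_one]
  · refine BraidExt.minpoly_eq_cubic_of_eigenvectors hr (hcub i) fun μ hμ => ?_
    rw [hσ]
    exact BraidExt.exists_eigenvector hr hn hμ i
  · exact BraidExt.isDiagonalizable_of_aeval_cubic hr (hcub i)
  · rw [Subgroup.zpowers_le]
    exact hpow i r hev dvd_rfl
  · rw [Subgroup.zpowers_le]
    exact hpow i (2 * r) (even_two_mul r) (Dvd.intro_left 2 rfl)
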